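/- **Setting.** For each $n$ there is a target network ($m=1$) and source networks $m=2,\dots,M$ on $d$ common nodes; $d,M$, the community numbers $K_m$, the index set $\mathcal I\subseteq\{2,\dots,M\}$ of informative sources ($\mathcal I\ne\emptyset$) and all parameters may depend on $n$, and $d\to\infty$. The shared dimension $K_s\ge1$ is fixed, $K_s<K_1$ and $K_s\le K_m$. Put $\mathcal I^c=[M]\setminus(\{1\}\cup\mathcal I)$. Network $m$ follows a DCMM: $\theta^m_i>0$; $\Pi^m$ is a $d\times K_m$ matrix whose rows are probability vectors; $P^m$ is symmetric and entrywise nonnegative; $\Theta^m=\mathrm{diag}(\theta^m)$, $H_m=\Theta^m\Pi^mP^m(\Pi^m)^\top\Theta^m$; the adjacency matrix $X_m$ is symmetric with entries in $\{0,1\}$ and $\mathbb P((X_m)_{ij}=1)=(H_m)_{ij}$. Eigenvalues $\lambda_k$ are ordered by decreasing absolute value (and are $0$ for $k>d$), "leading" eigenvectors are orthonormal and refer to this order, $\Delta_m=|\lambda_{K_m}(H_m)|>0$ and $\Delta=\Delta_1$. $\Xi_m$ and $\hat\Xi_m$ are $K_m$ leading eigenvectors of $H_m$ and $X_m$. There are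 matrices $\Xi_m^s$ ($d\times K_s$) and $\Xi_m^p$ ($d\times(K_m-K_s)$) with orthonormal columns, $\Xi_m\Xi_m^\top=\Xi_m^p(\Xi_m^p)^\top+\Xi_m^s(\Xi_m^s)^\top$ and $\Xi_m^s(\Xi_m^s)^\top\Xi_m^p(\Xi_m^p)^\top=0$. Let $\mathcal O(d,K_s)=\{\Xi\in\mathbb R^{d\times K_s}:\Xi^\top\Xi=I\}$. $\|\cdot\|_2$ is the spectral norm of a matrix, $\theta^m_{\max},\theta^m_{\min}$ are the largest and smallest entries of $\theta^m$, and $\lesssim,\asymp$ hold with constants that do not depend on $n$ or $m$. **Assumptions.** 1. $\theta^m_{\max}\asymp\theta^1_{\max}$ and $\|\theta^m\|_1\asymp\|\theta^1\|_1$ for $m\in\{1\}\cup\mathcal I$. 2. With $E_m=X_m-H_m$ there are rates $r_m,r>0$ with $\sup_{q\ge1}q^{-1}(\mathbb E\|E_m\|_2^q)^{1/q}\lesssim r_m$ for all $m\in[M]$ and $r_m\lesssim r$ for $m\in\{1\}\cup\mathcal I$. 3. $\|\Xi_m^s(\Xi_m^s)^\top-\Xi_1^s(\Xi_1^s)^\top\|_F\le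 h$ for $m\in\mathcal I$, where $h\ge 0$; and $\big\|\frac1{|\mathcal I|+1}\sum_{m\in\{1\}\cup\mathcal I}\Xi_m^p(\Xi_m^p)^\top\big\|_2\le g_{|\mathcal I|+1}$ for a sequence of constants $g_j\in(0,1)$, $j\ge2$, with $g_j\to0$ as $j\to\infty$. 4. $\beta,\tilde\beta>0$, $\tilde\beta=o(1)$, $\beta=o(\tilde\beta)$; $\lambda_1(H_1)-\lambda_2(H_1)\asymp\|\theta^1\|_2^2/K_1$; $\lambda_{K_1-K_s}(H_1^p)-\lambda_{K_1+1}(H_1^p)\asymp\tilde\beta\|\theta^1\|_2^2/K_1$ for $H_1^p=(I-\Xi_1^s(\Xi_1^s)^\top)H_1(I-\Xi_1^s(\Xi_1^s)^\top)$; $\Delta=\beta\|\theta^1\|_2^2/K_1$; $\lambda_1(H_1)-|\lambda_2(H_1)|\asymp\lambda_1(H_1)$; $|\lambda_k(H_1)|\lesssim\tilde\beta\|\theta^1\|_2^2/K_1$ for $2\le k\le K_1$. Moreover $\Delta\lesssim\Delta_m$ for $m\in\mathcal I$. 5. $\theta^1_{\max}\lesssim1$ and $\dfrac{\sqrt{\theta^1_{\max}\|\theta^1\|_1}}{\|\theta^1\|_2^2}\cdot\dfrac{\|\theta^1\|_2}{(\theta^1_{\min})^2\sqrt{\log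 d}}\to0$. 6. $G=K_1\|\theta^1\|_2^{-2}(\Pi^1)^\top(\Theta^1)^2\Pi^1$ is invertible, and $\max_{k,l}|P^1_{kl}|$, $\|G\|_2$, $\|G^{-1}\|_2$ are bounded. 7. The singular values of $P^1G$ satisfy $\sigma_2\le(1-c_1)\sigma_1$ for a constant $c_1\in(0,1)$, and $c_2\beta_n\le\sigma_{K_1}\le\sigma_2\le c_2^{-1}\beta_n$ for a constant $c_2>0$ and a sequence $\beta_n\in(0,1)$. 8. $P^1G$ has a first right singular vector $\eta$ with $\eta_k>0$ for $1\le k\le K_s$ and $\max_{k\le K_s}\eta_k\lesssim\min_{k\le K_s}\eta_k$. 9. There is a constant $d_\tau>0$ with $K_s-\mathrm{tr}[\Xi_m\Xi_m^\top\Xi_1^s(\Xi_1^s)^\top]>d_\tau$ for all $m\in\mathcal I^c$. The number $M$ of networks is bounded or, more generally, $\log M\cdot\max\{r/\Delta,\max_{m\in\mathcal I^c}r_m/\Delta_m\}\to0$. For integers $L\ge1$, $p>K_s$ (which may depend on $n$) and a constant $c_0>0$ let $$R=\sqrt{\tfrac{K_s}{|\mathcal I|}}\frac r\Delta+\sqrt{K_s}\frac{r^2}{\Delta^2}+h,\qquad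 \mathbf S=\sqrt{\tfrac{K_sd}{L|\mathcal I|p}}\frac r\Delta+\sqrt{\tfrac{K_s}{|\mathcal I|}}\frac r\Delta+\sqrt{K_s}\exp\Big(-\tfrac{c_0}8\sqrt{\tfrac pd}\,R^{-1}\Big)+\sqrt{\tfrac{K_sd}{Lp}}\,h .$$ **Theorem.** Suppose that $\mathbf S+\max_{m\in\mathcal I^c}r_m/\Delta_m=o(d_\tau)$ as $d\to\infty$ and $h\to0$ (the maximum is $0$ if $\mathcal I^c=\emptyset$). Then for every $c\in(0.5,1)$ and every $\tau\in[(1-c)d_\tau,c\,d_\tau]$ (possibly depending on $n$), with probability tending to $1$ the following holds: every oracle shared-subspace estimator, i.e. every maximizer over $\Xi\in\mathcal O(d,K_s)$ of $$\frac1M\sum_{m\in\{1\}\cup\mathcal I}\mathrm{tr}(\hat\Xi_m\hat\Xi_m^\top\Xi\Xi^\top),$$ is a local maximizer on $\mathcal O(d,K_s)$ of the truncated objective $$\frac1M\mathrm{tr}(\hat\Xi_1\hat\Xi_1^\top\Xi\Xi^\top)+\sum_{m=2}^M\frac1M\max\{\mathrm{tr}(\hat\Xi_m\hat\Xi_m^\top\Xi\Xi^\top),\,K_s-\tau\}.$$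 -/

import Mathlib

open Filter Topology MeasureTheory Asymptotics
open scoped Matrix ENNReal

namespace TDCMM

noncomputable section

/-! ### Matrices -/

/-- The set `O(d,k)` of real `d × k` matrices with orthonormal columns. -/
def stiefel (d k : ℕ) : Set (Matrix (Fin d) (Fin k) ℝ) := {U | Uᵀ * U = 1}

/-- The projection matrix `U Uᵀ`. -/
def proj {d k : ℕ} (U : Matrix (Fin d) (Fin k) ℝ) : Matrix (Fin d) (Fin d) ℝ := U * Uᵀ

/-- Spectral norm of a square matrix. -/
def specNorm {d : ℕ} (A : Matrix (Fin d) (Fin d) ℝ) : ℝ :=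
  ‖Matrix.toEuclideanCLM (n := Fin d) (𝕜 := ℝ) A‖

/-- Frobenius norm. -/
def frobNorm {d k : ℕ} (A : Matrix (Fin d) (Fin k) ℝ) : ℝ := √(∑ i, ∑ j, A i j ^ 2)

/-- The `k`-th largest singular value (`k = 1, 2, …`) of a square matrix. -/
def singVal {d : ℕ} (A : Matrix (Fin d) (Fin d) ℝ) (k : ℕ) : ℝ :=
  (Matrix.toEuclideanLin A).singularValues (k - 1)

/-- The columns of `U` are an orthonormal basis of eigenvectors of `A`, for the eigenvalues
`lam 1, …, lam d`, which are listed with multiplicity by decreasing absolute value. -/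
def IsEigensystem {d : ℕ} (A : Matrix (Fin d) (Fin d) ℝ) (lam : ℕ → ℝ)
    (U : Matrix (Fin d) (Fin d) ℝ) : Prop :=
  Uᵀ * U = 1 ∧ A * U = U * Matrix.diagonal (fun i : Fin d => lam ((i : ℕ) + 1)) ∧
    ∀ i j : Fin d, i ≤ j → |lam ((j : ℕ) + 1)| ≤ |lam ((i : ℕ) + 1)|

/-- `lam k` is the `k`-th eigenvalue `λ_k(A)` (`k = 1, 2, …`, by decreasing absolute value); the
list is continued by zero for `k > d`. -/
def IsSpectrum {d : ℕ} (A : Matrix (Fin d) (Fin d) ℝ) (lam : ℕ → ℝ) : Prop :=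
  (∃ U, IsEigensystem A lam U) ∧ ∀ k, d < k → lam k = 0

/-- The columns of `V` are `k` leading eigenvectors of `A`. -/
def IsLeading {d k : ℕ} (A : Matrix (Fin d) (Fin d) ℝ) (V : Matrix (Fin d) (Fin k) ℝ) : Prop :=
  ∃ (hk : k ≤ d) (lam : ℕ → ℝ) (U : Matrix (Fin d) (Fin d) ℝ),
    IsEigensystem A lam U ∧ V = U.submatrix id (Fin.castLE hk)

/-! ### Comparison of sequences, sub-exponential norm -/

/-- `a ≲ b`. -/
def Lesssim (a b : ℕ → ℝ) : Prop := ∃ C > 0, ∀ n, a n ≤ C * b n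

/-- `a ≍ b`. -/
def Asymp (a b : ℕ → ℝ) : Prop := Lesssim a b ∧ Lesssim b a

/-- The sub-exponential norm `sup_{q ≥ 1} q⁻¹ (E |Y|^q)^{1/q}`. -/
def psiOneNorm {Ω : Type*} [MeasurableSpace Ω] (μ : Measure Ω) (Y : Ω → ℝ) : ℝ≥0∞ :=
  ⨆ (q : ℝ) (_ : 1 ≤ q), ENNReal.ofReal q⁻¹ * eLpNorm Y (ENNReal.ofReal q) μ

/-! ### The degree-corrected mixed-membership model -/

/-- Parameters of a DCMM network with `d` nodes and `K` communities. -/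
structure DCMM (d K : ℕ) where
  /-- degree heterogeneity parameters -/
  θ : Fin d → ℝ
  /-- mixed memberships, one row per node -/
  Pi : Matrix (Fin d) (Fin K) ℝ
  /-- community connectivity -/
  P : Matrix (Fin K) (Fin K) ℝ
  θ_pos : ∀ i, 0 < θ i
  Pi_nonneg : ∀ i k, 0 ≤ Pi i k
  Pi_sum : ∀ i, ∑ k, Pi i k = 1
  P_symm : Pᵀ = P
  P_nonneg : ∀ k l, 0 ≤ P k l

namespace DCMM

variable {d K : ℕ} (N : DCMM d K)

/-- The matrix `Θ = diag(θ₁, …, θ_d)`. -/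
def Theta : Matrix (Fin d) (Fin d) ℝ := Matrix.diagonal N.θ

/-- The connection probability matrix `H = Θ Π P Πᵀ Θᵀ`. -/
def H : Matrix (Fin d) (Fin d) ℝ := N.Theta * N.Pi * N.P * N.Piᵀ * N.Thetaᵀ

/-- Largest degree parameter. -/
def θmax : ℝ := ⨆ i, N.θ i

/-- Smallest degree parameter. -/
def θmin : ℝ := ⨅ i, N.θ i

/-- `‖θ‖₁`. -/
def θnorm1 : ℝ := ∑ i, |N.θ i|

/-- `‖θ‖₂`. -/
def θnorm2 : ℝ := √(∑ i, N.θ i ^ 2)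

/-- `G = K ‖θ‖₂⁻² (Πᵀ Θ² Π)`. -/
def G : Matrix (Fin K) (Fin K) ℝ := ((K : ℝ) * (N.θnorm2 ^ 2)⁻¹) • (N.Piᵀ * N.Theta ^ 2 * N.Pi)

/-- `err = (√(θ_max ‖θ‖₁) / ‖θ‖₂²) · (‖θ‖₂ / (θ_min² √(log d)))`. -/
def err : ℝ := √(N.θmax * N.θnorm1) / N.θnorm2 ^ 2 * (N.θnorm2 / (N.θmin ^ 2 * √(Real.log d)))

end DCMM

/-- A target network (index `0`) and `N` source networks on `d` common nodes, with a set of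
informative sources, and with shared-private decompositions (shared dimension `Ks`). -/
structure Networks (d N Ks : ℕ) where
  /-- numbers of communities -/
  K : Fin (N + 1) → ℕ
  /-- the networks -/
  net : ∀ m, DCMM d (K m)
  /-- indices of the informative sources -/
  info : Finset (Fin (N + 1))
  /-- eigenvalues `λ_1(H_m), λ_2(H_m), …` -/
  lam : Fin (N + 1) → ℕ → ℝ
  /-- leading `K_m` eigenvectors of `H_m` -/
  Xi : ∀ m, Matrix (Fin d) (Fin (K m)) ℝ
  /-- basis of the shared subspace of network `m` -/
  XiS : Fin (N + 1) → Matrix (Fin d) (Fin Ks) ℝ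
  /-- basis of the private subspace of network `m` -/
  XiP : ∀ m, Matrix (Fin d) (Fin (K m - Ks)) ℝ
  Ks_pos : 1 ≤ Ks
  Ks_lt : Ks < K 0
  Ks_le : ∀ m, Ks ≤ K m
  target_notMem : 0 ∉ info
  info_nonempty : info.Nonempty
  lam_spec : ∀ m, IsSpectrum (net m).H (lam m)
  gap_pos : ∀ m, 0 < |lam m (K m)|
  Xi_leading : ∀ m, IsLeading (net m).H (Xi m)
  XiS_mem : ∀ m, XiS m ∈ stiefel d Ks
  XiP_mem : ∀ m, XiP m ∈ stiefel d (K m - Ks)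
  decomp : ∀ m, proj (Xi m) = proj (XiP m) + proj (XiS m)
  decomp_orth : ∀ m, proj (XiS m) * proj (XiP m) = 0

namespace Networks

variable {d N Ks : ℕ} (T : Networks d N Ks)

/-- `{1} ∪ I`: the target and the informative sources. -/
def pool : Finset (Fin (N + 1)) := insert 0 T.info

/-- `Iᶜ`: the non-informative sources. -/
def nonInfo : Finset (Fin (N + 1)) := T.poolᶜ

/-- `Δ_m = |λ_{K_m}(H_m)|`, the `K_m`-th eigengap of `H_m` (which has rank `K_m`). -/
def gap (m : Fin (N + 1)) : ℝ := |T.lam m (T.K m)|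

/-- `H_1^p = (I - Ξ_1^s (Ξ_1^s)ᵀ) H_1 (I - Ξ_1^s (Ξ_1^s)ᵀ)`. -/
def Hp : Matrix (Fin d) (Fin d) ℝ :=
  (1 - proj (T.XiS 0)) * (T.net 0).H * (1 - proj (T.XiS 0))

/-- `d_m = K_s - tr(Ξ_m Ξ_mᵀ Ξ_1^s (Ξ_1^s)ᵀ)`. -/
def deviation (m : Fin (N + 1)) : ℝ := Ks - (proj (T.Xi m) * proj (T.XiS 0)).trace

/-- Objective of the oracle problem, for estimated eigenvectors `V m`. -/
def oracleObj (V : ∀ m, Matrix (Fin d) (Fin (T.K m)) ℝ) (U : Matrix (Fin d) (Fin Ks) ℝ) : ℝ :=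
  1 / ((N + 1 : ℕ) : ℝ) * ∑ m ∈ T.pool, (proj (V m) * proj U).trace

/-- Objective of the truncated problem with threshold `τ`, for estimated eigenvectors `V m`. -/
def truncObj (V : ∀ m, Matrix (Fin d) (Fin (T.K m)) ℝ) (τ : ℝ) (U : Matrix (Fin d) (Fin Ks) ℝ) :
    ℝ :=
  1 / ((N + 1 : ℕ) : ℝ) * (proj (V 0) * proj U).trace +
    ∑ m ∈ Finset.univ.erase (0 : Fin (N + 1)),
      1 / ((N + 1 : ℕ) : ℝ) * max (proj (V m) * proj U).trace (Ks - τ)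

/-- `U` solves the oracle problem for estimated eigenvectors `V m`. -/
def IsOracleEstimator (V : ∀ m, Matrix (Fin d) (Fin (T.K m)) ℝ) (U : Matrix (Fin d) (Fin Ks) ℝ) :
    Prop :=
  U ∈ stiefel d Ks ∧ IsMaxOn (T.oracleObj V) (stiefel d Ks) U

/-- `max_{m ∈ Iᶜ} r_m / Δ_m` (zero when there is no non-informative source). -/
def maxNonInfoRatio (r : Fin (N + 1) → ℝ) : ℝ := ⨆ m : {m // m ∈ T.nonInfo}, r m / T.gap m

/-- `R = √(K_s/|I|) r/Δ + √K_s r²/Δ² + h`. -/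
def R (r h : ℝ) : ℝ :=
  √((Ks : ℝ) / T.info.card) * (r / T.gap 0) + √(Ks : ℝ) * (r ^ 2 / T.gap 0 ^ 2) + h

/-- The shared-subspace rate `S`, for `L` random projections of dimension `p`. -/
def S (L p : ℕ) (c₀ r h : ℝ) : ℝ :=
  √((Ks : ℝ) * d / (L * T.info.card * p)) * (r / T.gap 0)
    + √((Ks : ℝ) / T.info.card) * (r / T.gap 0)
    + √(Ks : ℝ) * Real.exp (-(c₀ / 8) * √((p : ℝ) / d) * (T.R r h)⁻¹)
    + √((Ks : ℝ) * d / (L * p)) * h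

end Networks

/-- `X m` is a random adjacency matrix (symmetric, with entries `0` and `1`) with
`P((X m)_{ij} = 1) = (H_m)_{ij}`. -/
structure IsObserved {d N Ks : ℕ} (T : Networks d N Ks) {Ω : Type*} [MeasurableSpace Ω]
    (μ : Measure Ω) (X : Fin (N + 1) → Ω → Matrix (Fin d) (Fin d) ℝ) : Prop where
  measurable : ∀ m i j, Measurable fun ω => X m ω i j
  symm : ∀ m ω, (X m ω)ᵀ = X m ω
  binary : ∀ m ω i j, X m ω i j = 0 ∨ X m ω i j = 1
  prob : ∀ m i j, μ {ω | X m ω i j = 1} = ENNReal.ofReal ((T.net m).H i j)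

/-! ### The assumptions, for a sequence of network collections -/

section Assumptions

variable {d N : ℕ → ℕ} {Ks : ℕ} (T : ∀ n, Networks (d n) (N n) Ks)

/-- The degree parameters of the informative sources are comparable with those of the target. -/
def DegreesComparable : Prop :=
  ∃ C₁ > 0, ∃ C₂ > 0, ∀ n, ∀ m ∈ (T n).pool,
    (C₁ * ((T n).net 0).θmax ≤ ((T n).net m).θmax ∧
      ((T n).net m).θmax ≤ C₂ * ((T n).net 0).θmax) ∧
    (C₁ * ((T n).net 0).θnorm1 ≤ ((T n).net m).θnorm1 ∧
      ((T n).net m).θnorm1 ≤ C₂ * ((T n).net 0).θnorm1)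

/-- `rm n m` is a sub-exponential rate for the noise `‖X_m - H_m‖₂` of each network, and `r n` is a
common rate for the target and the informative sources. -/
def NoiseRates {Ω : ℕ → Type*} [∀ n, MeasurableSpace (Ω n)] (μ : ∀ n, Measure (Ω n))
    (X : ∀ n, Fin (N n + 1) → Ω n → Matrix (Fin (d n)) (Fin (d n)) ℝ)
    (rm : ∀ n, Fin (N n + 1) → ℝ) (r : ℕ → ℝ) : Prop :=
  (∀ n m, 0 < rm n m) ∧ (∀ n, 0 < r n) ∧
  (∃ C > 0, ∀ n m, psiOneNorm (μ n) (fun ω => specNorm (X n m ω - ((T n).net m).H)) ≤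
    ENNReal.ofReal (C * rm n m)) ∧
  ∃ C > 0, ∀ n, ∀ m ∈ (T n).pool, rm n m ≤ C * r n

/-- Shared subspaces of informative sources are within `h n` of that of the target, and the
average private projection over the `M = |I| + 1` pooled networks has norm at most `g M`. -/
def SubspacesIdentifiable (h : ℕ → ℝ) (g : ℕ → ℝ) : Prop :=
  (∀ n, 0 ≤ h n) ∧
  (∀ n, ∀ m ∈ (T n).info, frobNorm (proj ((T n).XiS m) - proj ((T n).XiS 0)) ≤ h n) ∧
  (∀ M, 2 ≤ M → 0 < g M ∧ g M < 1) ∧ Tendsto g atTop (𝓝 0) ∧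
  ∀ n, specNorm ((1 / (((T n).info.card : ℝ) + 1)) • ∑ m ∈ (T n).pool, proj ((T n).XiP m)) ≤
    g ((T n).info.card + 1)

/-- The signal level `‖θ¹‖₂² / K_1`. -/
def signal (n : ℕ) : ℝ := ((T n).net 0).θnorm2 ^ 2 * ((T n).K 0 : ℝ)⁻¹

/-- Separation of the eigenvalues of the target. -/
def EigenvaluesSeparated (β βt : ℕ → ℝ) : Prop :=
  (∀ n, 0 < β n) ∧ (∀ n, 0 < βt n) ∧ Tendsto βt atTop (𝓝 0) ∧ β =o[atTop] βt ∧
  Asymp (fun n => (T n).lam 0 1 - (T n).lam 0 2) (signal T) ∧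
  (∃ lamP : ℕ → ℕ → ℝ, (∀ n, IsSpectrum (T n).Hp (lamP n)) ∧
    Asymp (fun n => lamP n ((T n).K 0 - Ks) - lamP n ((T n).K 0 + 1))
      (fun n => βt n * signal T n)) ∧
  (∀ n, (T n).gap 0 = β n * signal T n) ∧
  Asymp (fun n => (T n).lam 0 1 - |(T n).lam 0 2|) (fun n => (T n).lam 0 1) ∧
  ∃ C > 0, ∀ n k, 2 ≤ k → k ≤ (T n).K 0 → |(T n).lam 0 k| ≤ C * (βt n * signal T n)

/-- The eigengap `Δ_m` of each informative source is at least of the order of the eigengap `Δ` of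
the target. -/
def SourceSignal : Prop := ∃ C₀ > 0, ∀ n, ∀ m ∈ (T n).info, C₀ * (T n).gap 0 ≤ (T n).gap m

/-- Bounded degree parameters of the target and `err → 0`. -/
def DegreesBounded : Prop :=
  (∃ C > 0, ∀ n, ((T n).net 0).θmax ≤ C) ∧ Tendsto (fun n => ((T n).net 0).err) atTop (𝓝 0)

/-- `‖P¹‖_max`, `‖G‖₂` and `‖G⁻¹‖₂` are bounded. -/
def CommunitiesBounded : Prop :=
  ∃ C > 0, ∀ n, (∀ k l, |((T n).net 0).P k l| ≤ C) ∧ IsUnit ((T n).net 0).G.det ∧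
    specNorm ((T n).net 0).G ≤ C ∧ specNorm (((T n).net 0).G)⁻¹ ≤ C

/-- Conditions on the singular values of `P¹ G`. -/
def SingularValuesSeparated : Prop :=
  (∃ c₁ : ℝ, 0 < c₁ ∧ c₁ < 1 ∧ ∀ n, |singVal (((T n).net 0).P * ((T n).net 0).G) 2| ≤
    (1 - c₁) * singVal (((T n).net 0).P * ((T n).net 0).G) 1) ∧
  ∃ c₁ : ℝ, 0 < c₁ ∧ ∃ b : ℕ → ℝ, ∀ n, 0 < b n ∧ b n < 1 ∧
    c₁ * b n ≤ |singVal (((T n).net 0).P * ((T n).net 0).G) ((T n).K 0)| ∧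
    |singVal (((T n).net 0).P * ((T n).net 0).G) ((T n).K 0)| ≤
      |singVal (((T n).net 0).P * ((T n).net 0).G) 2| ∧
    |singVal (((T n).net 0).P * ((T n).net 0).G) 2| ≤ c₁⁻¹ * b n

/-- The first right singular vector `η` of `P¹ G` has (for a suitable sign) positive and comparable
entries, for the indices `1 ≤ k ≤ K_s`. -/
def SingularVectorPositive : Prop :=
  ∃ C > 0, ∀ n, ∃ η : Fin ((T n).K 0) → ℝ, η ⬝ᵥ η = 1 ∧
    ((((T n).net 0).P * ((T n).net 0).G)ᵀ * (((T n).net 0).P * ((T n).net 0).G)) *ᵥ η =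
      singVal (((T n).net 0).P * ((T n).net 0).G) 1 ^ 2 • η ∧
    (∀ k : Fin ((T n).K 0), (k : ℕ) < Ks → 0 < η k) ∧
    ∀ k l : Fin ((T n).K 0), (k : ℕ) < Ks → (l : ℕ) < Ks → η k / η l ≤ C

/-- Each non-informative source deviates from the target's shared subspace by more than `dτ`. -/
def NonInfoSeparated (dτ : ℝ) : Prop := ∀ n, ∀ m ∈ (T n).nonInfo, dτ < (T n).deviation m

/-- The number of networks is bounded or, more generally, its logarithm is negligible against the
signal-to-noise ratios of all networks. -/
def NetworkCountControlled (rm : ∀ n, Fin (N n + 1) → ℝ) (r : ℕ → ℝ) : Prop :=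
  (∃ B, ∀ n, N n + 1 ≤ B) ∨
  Tendsto (fun n => Real.log ((N n + 1 : ℕ) : ℝ) *
    max (r n / (T n).gap 0) ((T n).maxNonInfoRatio (rm n))) atTop (𝓝 0)

end Assumptions

end

end TDCMM

/-!
The argument is a deterministic perturbation bound on an event of probability tending to one.

Write `P = Ξ₁ˢ(Ξ₁ˢ)ᵀ`, `Q = UUᵀ` for an oracle estimator `U`, and `A_m = V_m V_mᵀ` for the estimated
eigenspaces. Suppose that `‖X_m - H_m‖ ≤ ε Δ_m` for every network `m` and `h ≤ ε`. As `H_m` has rank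
`K_m`, a Davis–Kahan bound in operator norm (`opNorm_proj_sub_proj_le`) gives
`‖A_m - Ξ_m Ξ_mᵀ‖ ≤ 4ε`. Hence the average of the `A_m` over the target and the informative sources
is within `O(ε)` of `P + B`, where `B` is the average private projection: `‖B‖ ≤ g < 1` and
`‖B P‖ = O(ε)`. Comparing the oracle objective at `U` with its value at `Ξ₁ˢ` yields
`(1 - g) (K_s - tr(P Q)) = O(ε)` (`mul_sub_trace_le_of_isOracleEstimator`), so that `Q` is close to
`P`. Every overlap `tr(A_m Q)` is then close to `tr(Ξ_m Ξ_mᵀ P)`, which is nearly `K_s` for an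
informative source and less than `K_s - dτ` for any other source. Since `τ` stays away from `0` and
from `dτ`, the truncation at `K_s - τ` is strictly inactive at `U` for the former and strictly active
for the latter. Near `U` the truncated objective is therefore the oracle objective plus a constant
(`isLocalMaxOn_truncObj`), and `U` maximizes the latter.

All overlaps are compared through `|tr(B UUᵀ)| ≤ ‖B‖ K_s`, so that neither the dimension `d` nor the
numbers `K_m` enter and a fixed `ε`, depending on `dτ`, `c`, `K_s` and `sup g`, suffices.

For such a fixed `ε` the noise event has probability tending to one (`tendsto_measure_noise_le`): the
sub-exponential norms give tails of order `exp(-a / ρ)` with a constant `a` and `ρ` the largest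
noise-to-signal ratio, and a union bound over the networks costs a factor `M` with `ρ log M → 0`
(`tendsto_ratio`).
-/

namespace TDCMM

/-! ### Operator norms, projections and overlaps -/

section Perturbation

open scoped Matrix.Norms.L2Operator

variable {d k l : ℕ}

lemma norm_toLp_sq {ι : Type*} [Fintype ι] (v : ι → ℝ) : ‖WithLp.toLp 2 v‖ ^ 2 = v ⬝ᵥ v := by
  rw [EuclideanSpace.norm_sq_eq]
  simp [dotProduct, sq]

lemma norm_toLp_mulVec_le (A : Matrix (Fin d) (Fin k) ℝ) (v : Fin k → ℝ) :
    ‖WithLp.toLp 2 (A *ᵥ v)‖ ≤ ‖A‖ * ‖WithLp.toLp 2 v‖ :=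
  A.l2_opNorm_mulVec (WithLp.toLp 2 v)

lemma dotProduct_self_mulVec_le (A : Matrix (Fin d) (Fin k) ℝ) (v : Fin k → ℝ) :
    (A *ᵥ v) ⬝ᵥ (A *ᵥ v) ≤ ‖A‖ ^ 2 * (v ⬝ᵥ v) := by
  rw [← norm_toLp_sq, ← norm_toLp_sq, ← mul_pow]
  gcongr
  exact norm_toLp_mulVec_le A v

lemma opNorm_le_of_dotProduct_self_le {A : Matrix (Fin d) (Fin k) ℝ} {c : ℝ} (hc : 0 ≤ c)
    (h : ∀ v, (A *ᵥ v) ⬝ᵥ (A *ᵥ v) ≤ c ^ 2 * (v ⬝ᵥ v)) : ‖A‖ ≤ c := by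
  rw [Matrix.l2_opNorm_def]
  refine ContinuousLinearMap.opNorm_le_bound _ hc fun x => ?_
  have h' := h (WithLp.ofLp x)
  rw [← norm_toLp_sq, ← norm_toLp_sq, ← mul_pow] at h'
  exact (sq_le_sq₀ (norm_nonneg _) (by positivity)).1 h'

lemma opNorm_transpose (A : Matrix (Fin d) (Fin k) ℝ) : ‖Aᵀ‖ = ‖A‖ := by
  rw [← Matrix.conjTranspose_eq_transpose_of_trivial, Matrix.l2_opNorm_conjTranspose]

/-- A lower bound of `A` on vectors by a multiple of `B` carries over to operator norms of
products with any `M`. -/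
lemma mul_opNorm_mul_le {A B : Matrix (Fin d) (Fin d) ℝ} {a : ℝ} (ha : 0 ≤ a)
    (h : ∀ v, a ^ 2 * ((B *ᵥ v) ⬝ᵥ (B *ᵥ v)) ≤ (A *ᵥ v) ⬝ᵥ (A *ᵥ v))
    (M : Matrix (Fin d) (Fin d) ℝ) : a * ‖B * M‖ ≤ ‖A * M‖ := by
  have : ‖a • (B * M)‖ ≤ ‖A * M‖ := by
    refine opNorm_le_of_dotProduct_self_le (norm_nonneg _) fun v => ?_
    refine le_trans ?_ (dotProduct_self_mulVec_le (A * M) v)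
    have := h (M *ᵥ v)
    simp only [Matrix.mulVec_mulVec] at this
    simp only [Matrix.smul_mulVec, smul_dotProduct, dotProduct_smul, smul_eq_mul]
    linarith
  rwa [norm_smul, Real.norm_of_nonneg ha] at this

lemma frobNorm_sq (A : Matrix (Fin d) (Fin k) ℝ) : frobNorm A ^ 2 = (Aᵀ * A).trace := by
  rw [frobNorm, Real.sq_sqrt (by positivity), Finset.sum_comm]
  simp [Matrix.trace, Matrix.mul_apply, sq]

lemma opNorm_le_frobNorm (A : Matrix (Fin d) (Fin k) ℝ) : ‖A‖ ≤ frobNorm A := by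
  refine opNorm_le_of_dotProduct_self_le (Real.sqrt_nonneg _) fun v => ?_
  rw [frobNorm, Real.sq_sqrt (by positivity), Finset.sum_mul]
  refine Finset.sum_le_sum fun i _ => ?_
  have := Finset.sum_mul_sq_le_sq_mul_sq Finset.univ (A i) v
  simpa [Matrix.mulVec, dotProduct, sq] using this

/-- The bound `|tr(B W Wᵀ)| ≤ ‖B‖ tr(W Wᵀ)`. -/
lemma abs_trace_mul_proj_le (B : Matrix (Fin d) (Fin d) ℝ) (W : Matrix (Fin d) (Fin k) ℝ) :
    |(B * proj W).trace| ≤ ‖B‖ * (proj W).trace := by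
  have h1 : ∀ C : Matrix (Fin d) (Fin d) ℝ,
      (C * proj W).trace = ∑ j, (W.col j) ⬝ᵥ (C *ᵥ W.col j) := by
    intro C
    rw [proj, ← Matrix.mul_assoc, Matrix.trace_mul_comm]
    simp only [Matrix.trace, Matrix.diag, Matrix.mul_apply, dotProduct, Matrix.mulVec,
      Matrix.transpose_apply, Matrix.col_apply]
  have h2 := h1 1
  simp only [one_mul, Matrix.one_mulVec] at h2
  rw [h1, h2, Finset.mul_sum]
  refine (Finset.abs_sum_le_sum_abs _ _).trans (Finset.sum_le_sum fun j _ => ?_)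
  set w := W.col j
  have h3 := abs_real_inner_le_norm (WithLp.toLp 2 (B *ᵥ w)) (WithLp.toLp 2 w)
  have h4 : inner ℝ (WithLp.toLp 2 (B *ᵥ w)) (WithLp.toLp 2 w) = w ⬝ᵥ (B *ᵥ w) := by
    simp [PiLp.inner_apply, dotProduct]
  rw [h4] at h3
  refine h3.trans ?_
  rw [← norm_toLp_sq, sq, ← mul_assoc]
  gcongr
  exact norm_toLp_mulVec_le B w

lemma trace_proj {U : Matrix (Fin d) (Fin k) ℝ} (hU : U ∈ stiefel d k) :
    (proj U).trace = k := by
  have : Uᵀ * U = 1 := hU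
  rw [proj, Matrix.trace_mul_comm, this]; simp

lemma proj_transpose (U : Matrix (Fin d) (Fin k) ℝ) : (proj U)ᵀ = proj U := by
  simp [proj]

lemma proj_mul_proj {U : Matrix (Fin d) (Fin k) ℝ} (hU : U ∈ stiefel d k) :
    proj U * proj U = proj U := by
  have : Uᵀ * U = 1 := hU
  rw [proj, Matrix.mul_assoc, ← Matrix.mul_assoc Uᵀ, this, Matrix.one_mul]

lemma opNorm_proj_le_one {U : Matrix (Fin d) (Fin k) ℝ} (hU : U ∈ stiefel d k) :
    ‖proj U‖ ≤ 1 := by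
  have h := Matrix.l2_opNorm_conjTranspose_mul_self (proj U)
  rw [Matrix.conjTranspose_eq_transpose_of_trivial, proj_transpose, proj_mul_proj hU] at h
  nlinarith [norm_nonneg (proj U)]

lemma trace_proj_mul_proj_nonneg (U : Matrix (Fin d) (Fin k) ℝ) (V : Matrix (Fin d) (Fin l) ℝ) :
    0 ≤ (proj U * proj V).trace := by
  have : (proj U * proj V).trace = ((Vᵀ * U)ᵀ * (Vᵀ * U)).trace := by
    rw [proj, proj, ← Matrix.mul_assoc, Matrix.trace_mul_comm, Matrix.transpose_mul,
      Matrix.transpose_transpose, Matrix.trace_mul_comm (Uᵀ * V)]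
    simp only [Matrix.mul_assoc]
  rw [this, ← frobNorm_sq]
  positivity

/-- Matrices that are close in operator norm have close overlaps with any `U` with orthonormal
columns. -/
lemma abs_trace_sub_le {A B : Matrix (Fin d) (Fin d) ℝ} {U : Matrix (Fin d) (Fin k) ℝ}
    (hU : U ∈ stiefel d k) {δ : ℝ} (h : ‖A - B‖ ≤ δ) :
    |(A * proj U).trace - (B * proj U).trace| ≤ k * δ := by
  rw [← Matrix.trace_sub, ← Matrix.sub_mul]
  refine (abs_trace_mul_proj_le _ U).trans ?_
  rw [trace_proj hU, mul_comm]
  gcongr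

/-- The overlap of a contraction with a projection of rank `k` is `2k`-Lipschitz in the
projection; the ambient dimension and the rank of the contraction do not enter. -/
lemma abs_trace_sub_le_of_contraction {A : Matrix (Fin d) (Fin d) ℝ} (hA : ‖A‖ ≤ 1)
    {U W : Matrix (Fin d) (Fin k) ℝ} (hU : U ∈ stiefel d k) (hW : W ∈ stiefel d k) {η : ℝ}
    (h : ‖proj U - proj W‖ ≤ η) :
    |(A * proj U).trace - (A * proj W).trace| ≤ 2 * k * η := by
  -- `Q - P = Q (Q - P) + (Q - P) P` for projections `Q`, `P`
  have e : (A * proj U).trace - (A * proj W).trace =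
      ((proj U - proj W) * A * proj U).trace + (A * (proj U - proj W) * proj W).trace := by
    have e1 : ((proj U - proj W) * A * proj U).trace
        = (A * (proj U * (proj U - proj W))).trace := by
      rw [Matrix.mul_assoc, Matrix.trace_mul_comm, Matrix.mul_assoc]
    rw [e1, ← Matrix.trace_add, ← Matrix.trace_sub, Matrix.mul_assoc A, ← Matrix.mul_add,
      ← Matrix.mul_sub]
    congr 2
    rw [Matrix.mul_sub, Matrix.sub_mul, proj_mul_proj hU, proj_mul_proj hW]
    abel
  rw [e]
  have a1 : ‖(proj U - proj W) * A‖ ≤ η := by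
    refine (Matrix.l2_opNorm_mul _ _).trans ?_
    nlinarith [norm_nonneg A, norm_nonneg (proj U - proj W)]
  have a2 : ‖A * (proj U - proj W)‖ ≤ η := by
    refine (Matrix.l2_opNorm_mul _ _).trans ?_
    nlinarith [norm_nonneg A, norm_nonneg (proj U - proj W)]
  have b1 := abs_trace_mul_proj_le ((proj U - proj W) * A) U
  have b2 := abs_trace_mul_proj_le (A * (proj U - proj W)) W
  rw [trace_proj hU] at b1
  rw [trace_proj hW] at b2
  refine (abs_add_le _ _).trans ?_
  have hk : (0 : ℝ) ≤ k := by positivity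
  nlinarith

/-! ### Perturbation of leading eigenvectors -/

/-- There is a nonzero vector orthogonal to `d - 1` given ones. -/
lemma exists_ne_zero_dotProduct_eq_zero (R : Fin d → Fin d → ℝ) (i : Fin d) :
    ∃ v : Fin d → ℝ, v ≠ 0 ∧ ∀ j, j ≠ i → R j ⬝ᵥ v = 0 := by
  have hdet : (Matrix.of (Function.update R i 0)).det = 0 :=
    Matrix.det_eq_zero_of_row_eq_zero i fun j => by simp
  obtain ⟨v, hv, h⟩ := Matrix.exists_mulVec_eq_zero_iff.2 hdet
  refine ⟨v, hv, fun j hj => ?_⟩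
  have := congrFun h j
  simpa [Matrix.mulVec, hj] using this

lemma dotProduct_self_conj_diagonal {U : Matrix (Fin d) (Fin d) ℝ} (hU : Uᵀ * U = 1)
    (w v : Fin d → ℝ) :
    ((U * Matrix.diagonal w * Uᵀ) *ᵥ v) ⬝ᵥ ((U * Matrix.diagonal w * Uᵀ) *ᵥ v) =
      ∑ i, w i ^ 2 * (Uᵀ *ᵥ v) i ^ 2 := by
  have h : ∀ a : Fin d → ℝ, (U *ᵥ a) ⬝ᵥ (U *ᵥ a) = a ⬝ᵥ a := by
    intro a
    rw [Matrix.dotProduct_mulVec, ← Matrix.mulVec_transpose, Matrix.mulVec_mulVec, hU,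
      Matrix.one_mulVec]
  rw [← Matrix.mulVec_mulVec, ← Matrix.mulVec_mulVec, h]
  simp only [dotProduct, Matrix.mulVec_diagonal]
  exact Finset.sum_congr rfl fun i _ => by ring

namespace IsEigensystem

variable {A B : Matrix (Fin d) (Fin d) ℝ} {lam lamA lamB : ℕ → ℝ}
  {U UA UB : Matrix (Fin d) (Fin d) ℝ}

lemma mul_transpose (h : IsEigensystem A lam U) : U * Uᵀ = 1 := mul_eq_one_comm.1 h.1

lemma dotProduct_self (h : IsEigensystem A lam U) (v : Fin d → ℝ) :
    v ⬝ᵥ v = ∑ i, (Uᵀ *ᵥ v) i ^ 2 := by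
  have := dotProduct_self_conj_diagonal h.1 (fun _ => 1) v
  simpa [Matrix.diagonal_one, h.mul_transpose] using this

lemma dotProduct_self_mulVec (h : IsEigensystem A lam U) (v : Fin d → ℝ) :
    (A *ᵥ v) ⬝ᵥ (A *ᵥ v) = ∑ i : Fin d, lam ((i : ℕ) + 1) ^ 2 * (Uᵀ *ᵥ v) i ^ 2 := by
  have hA : A = U * Matrix.diagonal (fun i : Fin d => lam ((i : ℕ) + 1)) * Uᵀ := by
    rw [← h.2.1, Matrix.mul_assoc, h.mul_transpose, Matrix.mul_one]
  conv_lhs => rw [hA]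
  exact dotProduct_self_conj_diagonal h.1 _ v

lemma proj_submatrix (hk : k ≤ d) (U : Matrix (Fin d) (Fin d) ℝ) :
    proj (U.submatrix id (Fin.castLE hk)) =
      U * Matrix.diagonal (fun i : Fin d => if (i : ℕ) < k then (1 : ℝ) else 0) * Uᵀ := by
  ext a b
  have h : (Finset.univ.map (Fin.castLEEmb hk)) =
      Finset.univ.filter fun i : Fin d => (i : ℕ) < k := by
    ext i
    simp only [Finset.mem_map, Finset.mem_univ, true_and, Finset.mem_filter]
    constructor
    · rintro ⟨j, rfl⟩; simp
    · intro hi; exact ⟨⟨i, hi⟩, by ext; simp⟩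
  rw [Matrix.mul_apply, proj, Matrix.mul_apply]
  simp only [Matrix.mul_diagonal, Matrix.submatrix_apply,
    Matrix.transpose_apply, id, mul_ite, mul_one, mul_zero, ite_mul, zero_mul]
  rw [← Finset.sum_filter, ← h, Finset.sum_map]
  simp

lemma dotProduct_self_proj (h : IsEigensystem A lam U) (hk : k ≤ d) (v : Fin d → ℝ) :
    (proj (U.submatrix id (Fin.castLE hk)) *ᵥ v) ⬝ᵥ
      (proj (U.submatrix id (Fin.castLE hk)) *ᵥ v) =
      ∑ i : Fin d, if (i : ℕ) < k then (Uᵀ *ᵥ v) i ^ 2 else 0 := by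
  rw [proj_submatrix, dotProduct_self_conj_diagonal h.1]
  exact Finset.sum_congr rfl fun i _ => by split_ifs <;> simp

lemma dotProduct_self_compl (h : IsEigensystem A lam U) (hk : k ≤ d) (v : Fin d → ℝ) :
    (A * (1 - proj (U.submatrix id (Fin.castLE hk)))) *ᵥ v ⬝ᵥ
      (A * (1 - proj (U.submatrix id (Fin.castLE hk)))) *ᵥ v =
      ∑ i : Fin d, if (i : ℕ) < k then 0 else lam ((i : ℕ) + 1) ^ 2 * (Uᵀ *ᵥ v) i ^ 2 := by
  rw [← Matrix.mulVec_mulVec, h.dotProduct_self_mulVec]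
  refine Finset.sum_congr rfl fun i _ => ?_
  have : Uᵀ *ᵥ ((1 - proj (U.submatrix id (Fin.castLE hk))) *ᵥ v) =
      Matrix.diagonal (fun i : Fin d => if (i : ℕ) < k then (0 : ℝ) else 1) *ᵥ (Uᵀ *ᵥ v) := by
    rw [Matrix.mulVec_mulVec, Matrix.mulVec_mulVec, proj_submatrix, Matrix.mul_sub, Matrix.mul_one,
      ← Matrix.mul_assoc, ← Matrix.mul_assoc, h.1, Matrix.one_mul]
    congr 1
    rw [sub_eq_iff_eq_add, ← Matrix.add_mul, Matrix.diagonal_add]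
    conv_lhs => rw [← Matrix.one_mul Uᵀ, ← Matrix.diagonal_one]
    congr 2
    ext i
    split_ifs <;> simp
  rw [this, Matrix.mulVec_diagonal]
  split_ifs <;> simp

/-- Weyl's inequality for eigenvalues ordered by absolute value. -/
lemma abs_le_add_opNorm (hA : IsEigensystem A lamA UA) (hB : IsEigensystem B lamB UB)
    (i : Fin d) : |lamA ((i : ℕ) + 1)| ≤ |lamB ((i : ℕ) + 1)| + ‖A - B‖ := by
  -- a nonzero vector in the span of the first eigenvectors of `A` and of the last ones of `B`
  obtain ⟨v, hv, h⟩ := exists_ne_zero_dotProduct_eq_zero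
    (fun j => if j < i then UBᵀ j else UAᵀ j) i
  have hvA : ∀ j, i < j → (UAᵀ *ᵥ v) j = 0 := fun j hj => by
    have := h j hj.ne'
    rwa [if_neg hj.not_gt] at this
  have hvB : ∀ j, j < i → (UBᵀ *ᵥ v) j = 0 := fun j hj => by
    have := h j hj.ne
    rwa [if_pos hj] at this
  have h1 : |lamA ((i : ℕ) + 1)| ^ 2 * (v ⬝ᵥ v) ≤ (A *ᵥ v) ⬝ᵥ (A *ᵥ v) := by
    rw [hA.dotProduct_self, hA.dotProduct_self_mulVec, Finset.mul_sum]
    refine Finset.sum_le_sum fun j _ => ?_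
    rcases le_or_gt j i with hj | hj
    · gcongr ?_ * _
      rw [← sq_abs (lamA ((j : ℕ) + 1))]
      have := hA.2.2 j i hj
      gcongr
    · simp [hvA j hj]
  have h2 : (B *ᵥ v) ⬝ᵥ (B *ᵥ v) ≤ |lamB ((i : ℕ) + 1)| ^ 2 * (v ⬝ᵥ v) := by
    rw [hB.dotProduct_self v, hB.dotProduct_self_mulVec, Finset.mul_sum]
    refine Finset.sum_le_sum fun j _ => ?_
    rcases le_or_gt i j with hj | hj
    · gcongr ?_ * _
      rw [← sq_abs (lamB ((j : ℕ) + 1))]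
      have := hB.2.2 i j hj
      gcongr
    · simp [hvB j hj]
  rw [← norm_toLp_sq, ← norm_toLp_sq, ← mul_pow] at h1 h2
  have h1' := (sq_le_sq₀ (by positivity) (by positivity)).1 h1
  have h2' := (sq_le_sq₀ (by positivity) (by positivity)).1 h2
  have h3 := norm_toLp_mulVec_le (A - B) v
  have h4 : ‖WithLp.toLp 2 (A *ᵥ v)‖ ≤
      ‖WithLp.toLp 2 ((A - B) *ᵥ v)‖ + ‖WithLp.toLp 2 (B *ᵥ v)‖ := by
    refine le_trans (le_of_eq ?_) (norm_add_le _ _)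
    rw [← WithLp.toLp_add, ← Matrix.add_mulVec, sub_add_cancel]
  have hpos : 0 < ‖WithLp.toLp 2 v‖ := by
    rw [norm_pos_iff]
    simpa using hv
  refine le_of_mul_le_mul_right ?_ hpos
  linarith

/-- Eigenvalues beyond the rank vanish. -/
lemma eq_zero_of_factor (h : IsEigensystem A lam U) {C : Matrix (Fin d) (Fin k) ℝ}
    {D : Matrix (Fin k) (Fin d) ℝ} (hA : A = C * D) (i : Fin d) (hi : k ≤ i) :
    lam ((i : ℕ) + 1) = 0 := by
  -- a nonzero vector in the kernel of `D` and in the span of the first `i + 1` eigenvectors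
  obtain ⟨v, hv, h0⟩ := exists_ne_zero_dotProduct_eq_zero
    (fun j => if hj : (j : ℕ) < k then D ⟨j, hj⟩ else if j < i then 0 else Uᵀ j) i
  have hvU : ∀ j, i < j → (Uᵀ *ᵥ v) j = 0 := fun j hj => by
    have := h0 j hj.ne'
    rwa [dif_neg (not_lt.2 (hi.trans hj.le)), if_neg hj.not_gt] at this
  have hvD : D *ᵥ v = 0 := by
    ext j
    have := h0 ⟨j, by omega⟩ (by rw [Ne, Fin.ext_iff]; simp; omega)
    simpa [Matrix.mulVec] using this
  have h1 : |lam ((i : ℕ) + 1)| ^ 2 * (v ⬝ᵥ v) ≤ (A *ᵥ v) ⬝ᵥ (A *ᵥ v) := by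
    rw [h.dotProduct_self, h.dotProduct_self_mulVec, Finset.mul_sum]
    refine Finset.sum_le_sum fun j _ => ?_
    rcases le_or_gt j i with hj | hj
    · gcongr ?_ * _
      rw [← sq_abs (lam ((j : ℕ) + 1))]
      have := h.2.2 j i hj
      gcongr
    · simp [hvU j hj]
  have h2 : A *ᵥ v = 0 := by rw [hA, ← Matrix.mulVec_mulVec, hvD, Matrix.mulVec_zero]
  have hpos : 0 < v ⬝ᵥ v := by
    have : v ⬝ᵥ v ≠ 0 := by simpa using hv
    exact lt_of_le_of_ne (by rw [← norm_toLp_sq]; positivity) this.symm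
  rw [h2, dotProduct_zero, sq_abs] at h1
  have : lam ((i : ℕ) + 1) ^ 2 ≤ 0 := by nlinarith
  nlinarith [sq_nonneg (lam ((i : ℕ) + 1))]

/-- One half of a Davis–Kahan bound: if the first `k` eigenvalues of `A` are at least `a` and the
others of `B` at most `s`, in absolute value, then the leading eigenspace of `A` is nearly
orthogonal to the trailing eigenspace of `B`. -/
lemma mul_opNorm_proj_mul_compl_le (hA : IsEigensystem A lamA UA) (hB : IsEigensystem B lamB UB)
    (hk : k ≤ d) {a s : ℝ} (ha : 0 ≤ a) (hs : 0 ≤ s)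
    (hlamA : ∀ i : Fin d, (i : ℕ) < k → a ≤ |lamA ((i : ℕ) + 1)|)
    (hlamB : ∀ i : Fin d, k ≤ (i : ℕ) → |lamB ((i : ℕ) + 1)| ≤ s) :
    a * ‖proj (UA.submatrix id (Fin.castLE hk)) *
      (1 - proj (UB.submatrix id (Fin.castLE hk)))‖ ≤ s + ‖A - B‖ := by
  have h1 : ∀ v, a ^ 2 * ((proj (UA.submatrix id (Fin.castLE hk)) *ᵥ v) ⬝ᵥ
      (proj (UA.submatrix id (Fin.castLE hk)) *ᵥ v)) ≤ (A *ᵥ v) ⬝ᵥ (A *ᵥ v) := by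
    intro v
    rw [hA.dotProduct_self_proj hk, hA.dotProduct_self_mulVec, Finset.mul_sum]
    refine Finset.sum_le_sum fun i _ => ?_
    split_ifs with hi
    · rw [← sq_abs (lamA _)]
      have := hlamA i hi
      gcongr
    · rw [mul_zero]; positivity
  have h2 : ‖B * (1 - proj (UB.submatrix id (Fin.castLE hk)))‖ ≤ s := by
    refine opNorm_le_of_dotProduct_self_le hs fun v => ?_
    rw [hB.dotProduct_self_compl hk, hB.dotProduct_self, Finset.mul_sum]
    refine Finset.sum_le_sum fun i _ => ?_
    split_ifs with hi
    · positivity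
    · rw [← sq_abs (lamB _)]
      have := hlamB i (not_lt.1 hi)
      gcongr
  have h3 : ‖1 - proj (UB.submatrix id (Fin.castLE hk))‖ ≤ 1 := by
    refine opNorm_le_of_dotProduct_self_le zero_le_one fun v => ?_
    have hI : IsEigensystem (1 : Matrix (Fin d) (Fin d) ℝ) (fun _ => 1) UB :=
      ⟨hB.1, by simp [Matrix.diagonal_one], fun _ _ _ => le_rfl⟩
    have := hI.dotProduct_self_compl hk v
    rw [Matrix.one_mul] at this
    rw [this, hB.dotProduct_self, Finset.mul_sum]
    refine Finset.sum_le_sum fun i _ => ?_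
    split_ifs with hi
    · positivity
    · simp
  refine (mul_opNorm_mul_le ha h1 _).trans ?_
  have h4 : A * (1 - proj (UB.submatrix id (Fin.castLE hk))) =
      B * (1 - proj (UB.submatrix id (Fin.castLE hk))) +
        (A - B) * (1 - proj (UB.submatrix id (Fin.castLE hk))) := by
    rw [← Matrix.add_mul, add_sub_cancel]
  rw [h4]
  refine (norm_add_le _ _).trans ?_
  have h5 := Matrix.l2_opNorm_mul (A - B) (1 - proj (UB.submatrix id (Fin.castLE hk)))
  nlinarith [norm_nonneg (A - B)]

end IsEigensystem

lemma IsLeading.mem_stiefel {A : Matrix (Fin d) (Fin d) ℝ} {V : Matrix (Fin d) (Fin k) ℝ}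
    (h : IsLeading A V) : V ∈ stiefel d k := by
  obtain ⟨hk, lam, U, hU, rfl⟩ := h
  show _ = _
  ext i j
  have := congrFun (congrFun hU.1 (Fin.castLE hk i)) (Fin.castLE hk j)
  simpa [Matrix.mul_apply, Matrix.one_apply] using this

/-- A Davis–Kahan bound: the leading eigenspaces of dimension `k` of a matrix `A` of rank `k` and of
a perturbation `B`, when the perturbation is small compared with the smallest nonzero eigenvalue. -/
lemma opNorm_proj_sub_proj_le {A B : Matrix (Fin d) (Fin d) ℝ} {V W : Matrix (Fin d) (Fin k) ℝ}
    (hV : IsLeading A V) (hW : IsLeading B W) {lam : ℕ → ℝ} (hlam : IsSpectrum A lam)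
    {C : Matrix (Fin d) (Fin k) ℝ} {D : Matrix (Fin k) (Fin d) ℝ} (hA : A = C * D)
    (hk : 0 < k) (hpos : 0 < |lam k|) {ε : ℝ} (hε : ε ≤ 1 / 2) (hE : ‖B - A‖ ≤ ε * |lam k|) :
    ‖proj W - proj V‖ ≤ 4 * ε := by
  obtain ⟨hkd, lamA, UA, hUA, rfl⟩ := hV
  obtain ⟨_, lamB, UB, hUB, rfl⟩ := hW
  obtain ⟨⟨U0, hU0⟩, -⟩ := hlam
  have hE' : ‖A - B‖ ≤ ε * |lam k| := by rwa [norm_sub_rev]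
  have hε0 : 0 ≤ ε := by
    have := (norm_nonneg _).trans hE
    exact nonneg_of_mul_nonneg_left this hpos
  set i0 : Fin d := ⟨k - 1, by omega⟩ with hi0
  have hi0' : (i0 : ℕ) + 1 = k := by simp [hi0]; omega
  have hlamA : ∀ i : Fin d, (i : ℕ) < k → |lam k| ≤ |lamA ((i : ℕ) + 1)| := by
    intro i hi
    have h1 := hU0.abs_le_add_opNorm hUA i0
    have h2 := hUA.2.2 i i0 (by rw [Fin.le_def]; simp [hi0]; omega)
    rw [sub_self, norm_zero, add_zero, hi0'] at h1
    rw [hi0'] at h2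
    exact h1.trans h2
  have hzA : ∀ i : Fin d, k ≤ (i : ℕ) → |lamA ((i : ℕ) + 1)| ≤ 0 := fun i hi => by
    rw [hUA.eq_zero_of_factor hA i hi, abs_zero]
  have hlamB : ∀ i : Fin d, (i : ℕ) < k → |lam k| / 2 ≤ |lamB ((i : ℕ) + 1)| := by
    intro i hi
    have h1 := hUA.abs_le_add_opNorm hUB i
    have h2 := hlamA i hi
    nlinarith
  have hzB : ∀ i : Fin d, k ≤ (i : ℕ) → |lamB ((i : ℕ) + 1)| ≤ ε * |lam k| := by
    intro i hi
    have h1 := hUB.abs_le_add_opNorm hUA i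
    have h2 := hzA i hi
    linarith
  have m1 := hUA.mul_opNorm_proj_mul_compl_le hUB hkd hpos.le (by positivity) hlamA hzB
  have m2 := hUB.mul_opNorm_proj_mul_compl_le hUA hkd (by positivity) le_rfl hlamB hzA
  set P := proj (UA.submatrix id (Fin.castLE hkd)) with hP
  set Q := proj (UB.submatrix id (Fin.castLE hkd)) with hQ
  have e : Q - P = Q * (1 - P) - (P * (1 - Q))ᵀ := by
    rw [Matrix.transpose_mul, Matrix.transpose_sub, Matrix.transpose_one, hP, hQ, proj_transpose,
      proj_transpose]
    noncomm_ring
  rw [e]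
  refine (norm_sub_le _ _).trans ?_
  rw [opNorm_transpose]
  have m1' : ‖P * (1 - Q)‖ ≤ 2 * ε := by
    refine le_of_mul_le_mul_left (a := |lam k|) ?_ hpos
    linarith
  have m2' : ‖Q * (1 - P)‖ ≤ 2 * ε := by
    refine le_of_mul_le_mul_left (a := |lam k| / 2) ?_ (by positivity)
    linarith
  linarith

end Perturbation

/-! ### Consistency of oracle estimators -/

section Oracle

open scoped Matrix.Norms.L2Operator

variable {d k : ℕ}

lemma opNorm_one_sub_proj_le_one {U : Matrix (Fin d) (Fin k) ℝ} (hU : U ∈ stiefel d k) :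
    ‖1 - proj U‖ ≤ 1 := by
  have h := Matrix.l2_opNorm_conjTranspose_mul_self (1 - proj U)
  have e : (1 - proj U)ᵀ * (1 - proj U) = 1 - proj U := by
    rw [Matrix.transpose_sub, Matrix.transpose_one, proj_transpose, Matrix.sub_mul, Matrix.one_mul,
      Matrix.mul_sub, Matrix.mul_one, proj_mul_proj hU]
    abel
  rw [Matrix.conjTranspose_eq_transpose_of_trivial, e] at h
  nlinarith [norm_nonneg (1 - proj U)]

lemma opNorm_proj_sub_proj_sq_le {U W : Matrix (Fin d) (Fin k) ℝ} (hU : U ∈ stiefel d k)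
    (hW : W ∈ stiefel d k) :
    ‖proj U - proj W‖ ^ 2 ≤ 2 * (k - (proj W * proj U).trace) := by
  have h1 : ‖proj U - proj W‖ ^ 2 ≤ frobNorm (proj U - proj W) ^ 2 := by
    gcongr
    exact opNorm_le_frobNorm _
  refine h1.trans (le_of_eq ?_)
  rw [frobNorm_sq, Matrix.transpose_sub, proj_transpose, proj_transpose, Matrix.sub_mul,
    Matrix.mul_sub, Matrix.mul_sub, proj_mul_proj hU, proj_mul_proj hW, Matrix.trace_sub,
    Matrix.trace_sub, Matrix.trace_sub, trace_proj hU, trace_proj hW,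
    Matrix.trace_mul_comm (proj U) (proj W)]
  ring

/-- If `B` is symmetric with `‖B‖ ≤ g` and nearly annihilates the column space of `W`, then
`tr(B U Uᵀ)` only sees the part of `U` that is orthogonal to `W`. -/
lemma trace_mul_proj_le_of_nearly_orthogonal {B : Matrix (Fin d) (Fin d) ℝ} (hB : Bᵀ = B)
    {U W : Matrix (Fin d) (Fin k) ℝ} (hU : U ∈ stiefel d k) (hW : W ∈ stiefel d k) {g δ : ℝ}
    (hg : ‖B‖ ≤ g) (hδ : ‖B * proj W‖ ≤ δ) :
    (B * proj U).trace ≤ g * (k - (proj W * proj U).trace) + 2 * k * δ := by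
  have hδ0 : 0 ≤ δ := (norm_nonneg _).trans hδ
  -- split `B` into its blocks with respect to the column space of `W` and its complement
  have e : B * proj U = (1 - proj W) * B * (1 - proj W) * proj U +
      proj W * B * (1 - proj W) * proj U + B * proj W * proj U := by noncomm_ring
  have hproj : proj ((1 - proj W) * U) = (1 - proj W) * proj U * (1 - proj W) := by
    conv_lhs => rw [proj, Matrix.transpose_mul, Matrix.transpose_sub, Matrix.transpose_one,
      proj_transpose]
    rw [proj.eq_1 U]
    simp only [Matrix.mul_assoc]
  have e1 : ((1 - proj W) * B * (1 - proj W) * proj U).trace =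
      (B * proj ((1 - proj W) * U)).trace := by
    rw [hproj, Matrix.mul_assoc, Matrix.mul_assoc, Matrix.trace_mul_comm]
    simp only [Matrix.mul_assoc]
  have e2 : (proj ((1 - proj W) * U)).trace = k - (proj W * proj U).trace := by
    have : (1 - proj W) * (1 - proj W) = 1 - proj W := by
      rw [Matrix.sub_mul, Matrix.one_mul, Matrix.mul_sub, Matrix.mul_one, proj_mul_proj hW]
      abel
    rw [hproj, Matrix.trace_mul_comm, ← Matrix.mul_assoc, this, Matrix.sub_mul, Matrix.one_mul,
      Matrix.trace_sub, trace_proj hU]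
  have b1 := (le_abs_self _).trans (abs_trace_mul_proj_le B ((1 - proj W) * U))
  have hnn : 0 ≤ (proj ((1 - proj W) * U)).trace := by
    rw [proj, Matrix.trace_mul_comm, ← frobNorm_sq]; positivity
  have b1' : (B * proj ((1 - proj W) * U)).trace ≤ g * (k - (proj W * proj U).trace) := by
    rw [← e2]
    exact b1.trans (mul_le_mul_of_nonneg_right hg hnn)
  have n2 : ‖proj W * B * (1 - proj W)‖ ≤ δ := by
    have : ‖proj W * B‖ ≤ δ := by
      rw [← opNorm_transpose, Matrix.transpose_mul, proj_transpose, hB]; exact hδ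
    refine (Matrix.l2_opNorm_mul _ _).trans ?_
    have := opNorm_one_sub_proj_le_one hW
    nlinarith [norm_nonneg (1 - proj W), norm_nonneg (proj W * B)]
  have b2 := (le_abs_self _).trans (abs_trace_mul_proj_le (proj W * B * (1 - proj W)) U)
  have b3 := (le_abs_self _).trans (abs_trace_mul_proj_le (B * proj W) U)
  rw [trace_proj hU] at b2 b3
  rw [e, Matrix.trace_add, Matrix.trace_add, e1]
  have hk : (0 : ℝ) ≤ k := by positivity
  nlinarith

namespace Networks

variable {N Ks : ℕ} (T : Networks d N Ks)

lemma card_pool : (T.pool.card : ℝ) = T.info.card + 1 := by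
  rw [pool, Finset.card_insert_of_notMem T.target_notMem]; push_cast; rfl

variable {T} {V : ∀ m, Matrix (Fin d) (Fin (T.K m)) ℝ} {U : Matrix (Fin d) (Fin Ks) ℝ} {δ : ℝ}

/-- The leading eigenspaces of the pooled networks nearly contain the shared subspace of the
target. -/
lemma le_trace_proj_mul_shared {m : Fin (N + 1)} (hV : ‖proj (V m) - proj (T.Xi m)‖ ≤ δ)
    (hS : ‖proj (T.XiS m) - proj (T.XiS 0)‖ ≤ δ) :
    Ks - 2 * Ks * δ ≤ (proj (V m) * proj (T.XiS 0)).trace := by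
  have h1 := (abs_le.1 (abs_trace_sub_le (T.XiS_mem 0) hV)).1
  have h2 := (abs_le.1 (abs_trace_sub_le (T.XiS_mem 0) hS)).1
  rw [proj_mul_proj (T.XiS_mem 0), trace_proj (T.XiS_mem 0)] at h2
  have h3 := trace_proj_mul_proj_nonneg (T.XiP m) (T.XiS 0)
  rw [T.decomp m, Matrix.add_mul, Matrix.trace_add] at h1
  linarith

/-- An oracle estimator is close to the shared subspace of the target: the average of the estimated
projections is close to the shared projection plus an operator of norm `g < 1` that nearly
annihilates the shared subspace. -/
lemma mul_sub_trace_le_of_isOracleEstimator {g : ℝ}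
    (hV : ∀ m ∈ T.pool, ‖proj (V m) - proj (T.Xi m)‖ ≤ δ)
    (hS : ∀ m ∈ T.pool, ‖proj (T.XiS m) - proj (T.XiS 0)‖ ≤ δ)
    (hg : ‖(1 / ((T.info.card : ℝ) + 1)) • ∑ m ∈ T.pool, proj (T.XiP m)‖ ≤ g)
    (hU : T.IsOracleEstimator V U) :
    (1 - g) * (Ks - (proj (T.XiS 0) * proj U).trace) ≤ 6 * Ks * δ := by
  set G := (1 / ((T.info.card : ℝ) + 1)) • ∑ m ∈ T.pool, proj (T.XiP m) with hG
  set c : ℝ := (T.info.card : ℝ) + 1 with hc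
  have hc0 : 0 < c := by positivity
  have hcard : (T.pool.card : ℝ) = c := T.card_pool
  set t := (proj (T.XiS 0) * proj U).trace with ht
  have hGt : Gᵀ = G := by
    rw [hG, Matrix.transpose_smul, Matrix.transpose_sum]
    simp only [proj_transpose]
  have hGP : ‖G * proj (T.XiS 0)‖ ≤ δ := by
    rw [hG, Matrix.smul_mul, norm_smul, Finset.sum_mul, Real.norm_of_nonneg (by positivity)]
    have : ‖∑ m ∈ T.pool, proj (T.XiP m) * proj (T.XiS 0)‖ ≤ c * δ := by
      rw [← hcard, ← nsmul_eq_mul, ← Finset.sum_const]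
      refine norm_sum_le_of_le _ fun m hm => ?_
      have h0 : proj (T.XiP m) * proj (T.XiS m) = 0 := by
        have := congrArg Matrix.transpose (T.decomp_orth m)
        rwa [Matrix.transpose_mul, proj_transpose, proj_transpose, Matrix.transpose_zero] at this
      have h1 : proj (T.XiP m) * proj (T.XiS 0) =
          -(proj (T.XiP m) * (proj (T.XiS m) - proj (T.XiS 0))) := by
        rw [Matrix.mul_sub, h0]; simp
      rw [h1, norm_neg]
      refine (Matrix.l2_opNorm_mul _ _).trans ?_
      have h2 := opNorm_proj_le_one (T.XiP_mem m)
      have h3 := hS m hm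
      nlinarith [norm_nonneg (proj (T.XiP m)), norm_nonneg (proj (T.XiS m) - proj (T.XiS 0))]
    rw [one_div, inv_mul_le_iff₀ hc0]
    exact this
  have hb := trace_mul_proj_le_of_nearly_orthogonal hGt hU.1 (T.XiS_mem 0) hg hGP
  have hmax : ∑ m ∈ T.pool, (proj (V m) * proj (T.XiS 0)).trace ≤
      ∑ m ∈ T.pool, (proj (V m) * proj U).trace := by
    have := hU.2 (T.XiS_mem 0)
    simp only [Set.mem_ofPred_eq, oracleObj] at this
    exact le_of_mul_le_mul_left this (by positivity)
  have hlow : c * (Ks - 2 * Ks * δ) ≤ ∑ m ∈ T.pool, (proj (V m) * proj (T.XiS 0)).trace := by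
    rw [← hcard, ← nsmul_eq_mul]
    exact Finset.card_nsmul_le_sum _ _ _ fun m hm =>
      le_trace_proj_mul_shared (hV m hm) (hS m hm)
  have hup : ∑ m ∈ T.pool, (proj (V m) * proj U).trace ≤
      c * (t + 2 * Ks * δ) + ∑ m ∈ T.pool, (proj (T.XiP m) * proj U).trace := by
    rw [← hcard, ← nsmul_eq_mul, ← Finset.sum_const, ← Finset.sum_add_distrib]
    refine Finset.sum_le_sum fun m hm => ?_
    have h1 := (abs_le.1 (abs_trace_sub_le hU.1 (hV m hm))).2
    have h2 := (abs_le.1 (abs_trace_sub_le hU.1 (hS m hm))).2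
    rw [T.decomp m, Matrix.add_mul, Matrix.trace_add] at h1
    linarith
  have hsum : ∑ m ∈ T.pool, (proj (T.XiP m) * proj U).trace = c * (G * proj U).trace := by
    rw [hG, Matrix.smul_mul, Matrix.trace_smul, Finset.sum_mul, Matrix.trace_sum, smul_eq_mul]
    field_simp
  rw [hsum] at hup
  have : c * (Ks - 2 * Ks * δ) ≤ c * (t + 2 * Ks * δ + (g * (Ks - t) + 2 * Ks * δ)) := by
    have := mul_le_mul_of_nonneg_left hb hc0.le
    linarith
  have := le_of_mul_le_mul_left this hc0
  linarith

end Networks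

end Oracle

/-! ### The truncated objective near an oracle estimator -/

section Truncation

namespace Networks

variable {d N Ks : ℕ} {T : Networks d N Ks} {V : ∀ m, Matrix (Fin d) (Fin (T.K m)) ℝ}
  {U : Matrix (Fin d) (Fin Ks) ℝ} {τ : ℝ}

lemma continuous_trace_mul_proj (A : Matrix (Fin d) (Fin d) ℝ) :
    Continuous fun U : Matrix (Fin d) (Fin Ks) ℝ => (A * proj U).trace := by
  unfold proj
  fun_prop

/-- If the truncation is strictly inactive at `U` for the informative sources and strictly active
for the others, then near `U` the truncated objective is the oracle objective up to a constant. -/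
lemma isLocalMaxOn_truncObj (hU : T.IsOracleEstimator V U)
    (hinfo : ∀ m ∈ T.info, Ks - τ < (proj (V m) * proj U).trace)
    (hnon : ∀ m ∈ T.nonInfo, (proj (V m) * proj U).trace < Ks - τ) :
    IsLocalMaxOn (T.truncObj V τ) (stiefel d Ks) U := by
  have hset : Finset.univ.erase (0 : Fin (N + 1)) = T.info ∪ T.nonInfo := by
    ext m
    have := T.target_notMem
    simp only [Finset.mem_erase, Finset.mem_univ, and_true, Finset.mem_union, nonInfo, pool,
      Finset.mem_compl, Finset.mem_insert, not_or]
    by_cases hm : m = 0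
    · subst hm; simp [this]
    · simp only [hm, not_false_iff, true_and, ne_eq, true_iff]; exact em _
  have hdisj : Disjoint T.info T.nonInfo := by
    rw [Finset.disjoint_left]
    intro m hm
    simp [nonInfo, pool, hm]
  have hev : ∀ᶠ W in 𝓝 U, T.truncObj V τ W =
      T.oracleObj V W + ∑ m ∈ T.nonInfo, 1 / ((N + 1 : ℕ) : ℝ) * (Ks - τ) := by
    have h1 : ∀ᶠ W in 𝓝 U, ∀ m ∈ T.info, Ks - τ < (proj (V m) * proj W).trace :=
      (Finset.eventually_all _).2 fun m hm =>
        (continuous_trace_mul_proj _).continuousAt.eventually (lt_mem_nhds (hinfo m hm))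
    have h2 : ∀ᶠ W in 𝓝 U, ∀ m ∈ T.nonInfo, (proj (V m) * proj W).trace < Ks - τ :=
      (Finset.eventually_all _).2 fun m hm =>
        (continuous_trace_mul_proj _).continuousAt.eventually (gt_mem_nhds (hnon m hm))
    filter_upwards [h1, h2] with W hW1 hW2
    rw [truncObj, oracleObj, hset, Finset.sum_union hdisj, pool,
      Finset.sum_insert T.target_notMem, mul_add, Finset.mul_sum, ← add_assoc]
    congr 1
    · congr 1
      exact Finset.sum_congr rfl fun m hm => by rw [max_eq_left (hW1 m hm).le]
    · exact Finset.sum_congr rfl fun m hm => by rw [max_eq_right (hW2 m hm).le]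
  have hevU := hev.self_of_nhds
  filter_upwards [nhdsWithin_le_nhds hev, self_mem_nhdsWithin] with W hW hWmem
  rw [hW, hevU]
  have := hU.2 hWmem
  simp only [Set.mem_ofPred_eq] at this
  linarith

end Networks

end Truncation

section Deterministic

namespace Networks

open scoped Matrix.Norms.L2Operator

variable {d N Ks : ℕ} {T : Networks d N Ks}

/-- When the noise of each network is small compared with its eigengap, and the shared subspaces
of the informative sources are close to that of the target, every oracle estimator is a local
maximizer of the truncated objective. -/
lemma isLocalMaxOn_truncObj_of_small_noise {X : Fin (N + 1) → Matrix (Fin d) (Fin d) ℝ}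
    {V : ∀ m, Matrix (Fin d) (Fin (T.K m)) ℝ} (hV : ∀ m, IsLeading (X m) (V m))
    {U : Matrix (Fin d) (Fin Ks) ℝ} (hU : T.IsOracleEstimator V U)
    {ε γ g dτ c τ : ℝ} (hε0 : 0 ≤ ε) (hε : ε ≤ 1 / 2) (hγ : 0 < γ) (hgγ : g ≤ 1 - γ)
    (hE : ∀ m, specNorm (X m - (T.net m).H) ≤ ε * T.gap m)
    (hS : ∀ m ∈ T.info, frobNorm (proj (T.XiS m) - proj (T.XiS 0)) ≤ ε)
    (hg : specNorm ((1 / ((T.info.card : ℝ) + 1)) • ∑ m ∈ T.pool, proj (T.XiP m)) ≤ g)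
    (hdev : ∀ m ∈ T.nonInfo, dτ < T.deviation m)
    (hτ : τ ∈ Set.Icc ((1 - c) * dτ) (c * dτ))
    (hsmall : 2 * Ks * (4 * ε) + 2 * Ks * √(12 * Ks * (4 * ε) / γ) < (1 - c) * dτ) :
    IsLocalMaxOn (T.truncObj V τ) (stiefel d Ks) U := by
  set δ := 4 * ε with hδ
  set η := √(12 * Ks * δ / γ) with hη
  have hKs : (0 : ℝ) ≤ Ks := by positivity
  have hDK : ∀ m, ‖proj (V m) - proj (T.Xi m)‖ ≤ δ := fun m =>
    opNorm_proj_sub_proj_le (T.Xi_leading m) (hV m) (T.lam_spec m)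
      (C := (T.net m).Theta * (T.net m).Pi * (T.net m).P)
      (D := (T.net m).Piᵀ * (T.net m).Thetaᵀ)
      (by rw [DCMM.H]; simp only [Matrix.mul_assoc])
      (T.Ks_pos.trans (T.Ks_le m)) (T.gap_pos m) hε (hE m)
  have hS' : ∀ m ∈ T.pool, ‖proj (T.XiS m) - proj (T.XiS 0)‖ ≤ δ := by
    intro m hm
    rcases Finset.mem_insert.1 hm with rfl | hm
    · rw [sub_self, norm_zero]; positivity
    · exact (opNorm_le_frobNorm _).trans ((hS m hm).trans (by linarith))
  have hor := mul_sub_trace_le_of_isOracleEstimator (fun m _ => hDK m) hS' hg hU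
  have hQP : ‖proj U - proj (T.XiS 0)‖ ≤ η := by
    have h1 := opNorm_proj_sub_proj_sq_le hU.1 (T.XiS_mem 0)
    rw [hη]
    refine Real.le_sqrt_of_sq_le (h1.trans ?_)
    rw [le_div_iff₀ hγ]
    have h2 : 0 ≤ (Ks : ℝ) - (proj (T.XiS 0) * proj U).trace := by
      nlinarith [sq_nonneg ‖proj U - proj (T.XiS 0)‖]
    nlinarith
  have hlip : ∀ m, |(proj (V m) * proj U).trace - (proj (V m) * proj (T.XiS 0)).trace| ≤
      2 * Ks * η := fun m =>
    abs_trace_sub_le_of_contraction (opNorm_proj_le_one (hV m).mem_stiefel) hU.1 (T.XiS_mem 0) hQP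
  refine isLocalMaxOn_truncObj hU (fun m hm => ?_) fun m hm => ?_
  · have h1 := le_trace_proj_mul_shared (hDK m) (hS' m (Finset.mem_insert_of_mem hm))
    have h2 := (abs_le.1 (hlip m)).1
    linarith [hτ.1]
  · have h1 := (abs_le.1 (abs_trace_sub_le (T.XiS_mem 0) (hDK m))).2
    have h2 := (abs_le.1 (hlip m)).2
    have h3 := hdev m hm
    rw [deviation] at h3
    have h4 : (0 : ℝ) ≤ Ks * δ := by positivity
    linarith [hτ.2]

end Networks

end Deterministic

/-! ### Tail bounds for the noise -/

section Noise

/-- The exponential tail bound given by the sub-exponential norm, with Markov's inequality for the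
moment of order `q`. -/
lemma measure_ge_le_of_psiOneNorm_le {Ω : Type*} [MeasurableSpace Ω] {μ : Measure Ω} {Y : Ω → ℝ}
    (hY : AEStronglyMeasurable Y μ) {K t q : ℝ} (ht : 0 < t) (hq : 1 ≤ q)
    (hK : psiOneNorm μ Y ≤ ENNReal.ofReal K) (hqt : Real.exp 1 * q * K ≤ t) :
    μ {ω | t ≤ |Y ω|} ≤ ENNReal.ofReal (Real.exp (-q)) := by
  have hq0 : 0 < q := by linarith
  have h1 : ENNReal.ofReal q⁻¹ * eLpNorm Y (ENNReal.ofReal q) μ ≤ ENNReal.ofReal K :=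
    (le_iSup₂ (f := fun (q : ℝ) (_ : 1 ≤ q) =>
      ENNReal.ofReal q⁻¹ * eLpNorm Y (ENNReal.ofReal q) μ) q hq).trans hK
  have h2 : eLpNorm Y (ENNReal.ofReal q) μ ≤ ENNReal.ofReal (q * K) := by
    have h3 : ENNReal.ofReal q * (ENNReal.ofReal q⁻¹ * eLpNorm Y (ENNReal.ofReal q) μ) =
        eLpNorm Y (ENNReal.ofReal q) μ := by
      rw [← mul_assoc, ← ENNReal.ofReal_mul hq0.le, mul_inv_cancel₀ hq0.ne', ENNReal.ofReal_one,
        one_mul]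
    rw [← h3, ENNReal.ofReal_mul hq0.le]
    gcongr
  have h4 := meas_ge_le_mul_pow_eLpNorm_enorm μ (p := ENNReal.ofReal q) (by simpa using hq0)
    ENNReal.ofReal_ne_top hY (ε := ENNReal.ofReal t) (by simpa using ht) (by simp)
  have hset : {ω | t ≤ |Y ω|} = {ω | ENNReal.ofReal t ≤ ‖Y ω‖ₑ} := by
    ext ω
    simp only [Set.mem_ofPred_eq, Real.enorm_eq_ofReal_abs]
    rw [ENNReal.ofReal_le_ofReal_iff (abs_nonneg _)]
  rw [hset]
  refine h4.trans ?_
  rw [ENNReal.toReal_ofReal hq0.le, ← ENNReal.mul_rpow_of_nonneg _ _ hq0.le]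
  have h5 : (ENNReal.ofReal t)⁻¹ * eLpNorm Y (ENNReal.ofReal q) μ ≤
      ENNReal.ofReal (Real.exp (-1)) := by
    rw [← ENNReal.ofReal_inv_of_pos ht]
    refine (mul_le_mul_right h2 _).trans ?_
    rw [← ENNReal.ofReal_mul (by positivity)]
    refine ENNReal.ofReal_le_ofReal ?_
    rw [inv_mul_le_iff₀ ht, Real.exp_neg, ← div_eq_mul_inv, le_div_iff₀ (Real.exp_pos _)]
    linarith
  refine (ENNReal.rpow_le_rpow h5 hq0.le).trans ?_
  rw [ENNReal.ofReal_rpow_of_pos (Real.exp_pos _), ← Real.exp_mul]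
  simp

lemma measurable_specNorm_sub {d N Ks : ℕ} {T : Networks d N Ks} {Ω : Type*} [MeasurableSpace Ω]
    {μ : Measure Ω} {X : Fin (N + 1) → Ω → Matrix (Fin d) (Fin d) ℝ} (hX : IsObserved T μ X)
    (m : Fin (N + 1)) : Measurable fun ω => specNorm (X m ω - (T.net m).H) := by
  have h1 : Continuous fun f : Fin d → Fin d → ℝ => specNorm (Matrix.of f - (T.net m).H) := by
    unfold specNorm
    have h2 : Continuous (Matrix.toEuclideanCLM (n := Fin d) (𝕜 := ℝ)) :=
      LinearMap.continuous_of_finiteDimensional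
        (Matrix.toEuclideanCLM (n := Fin d) (𝕜 := ℝ)).toAlgEquiv.toLinearMap
    exact (h2.comp (continuous_id.sub continuous_const)).norm
  exact h1.measurable.comp (measurable_pi_iff.2 fun i => measurable_pi_iff.2 fun j =>
    hX.measurable m i j)

end Noise

/-! ### Noise-to-signal ratios of all networks -/

section Rates

namespace Networks

lemma maxNonInfoRatio_nonneg {d N Ks : ℕ} (T : Networks d N Ks) {rm : Fin (N + 1) → ℝ}
    (hrm : ∀ m, 0 < rm m) : 0 ≤ T.maxNonInfoRatio rm :=
  Real.iSup_nonneg fun m => div_nonneg (hrm m).le (abs_nonneg _)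

lemma two_le {d N Ks : ℕ} (T : Networks d N Ks) : 2 ≤ N + 1 := by
  obtain ⟨m, hm⟩ := T.info_nonempty
  have h0 : m ≠ 0 := fun h => T.target_notMem (h ▸ hm)
  have := m.isLt
  have : (m : ℕ) ≠ 0 := fun h => h0 (Fin.ext h)
  omega

lemma sqrt_mul_ratio_le_S {d N Ks : ℕ} (T : Networks d N Ks) (L p : ℕ) (c₀ : ℝ) {r h : ℝ}
    (hr : 0 < r) (hh : 0 ≤ h) :
    √((Ks : ℝ) / T.info.card) * (r / T.gap 0) ≤ T.S L p c₀ r h := by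
  have h1 : 0 ≤ r / T.gap 0 := div_nonneg hr.le (abs_nonneg _)
  rw [S]
  have a1 : 0 ≤ √((Ks : ℝ) * d / (L * T.info.card * p)) * (r / T.gap 0) := by positivity
  have a2 : 0 ≤ √(Ks : ℝ) * Real.exp (-(c₀ / 8) * √((p : ℝ) / d) * (T.R r h)⁻¹) := by
    positivity
  have a3 : 0 ≤ √((Ks : ℝ) * d / (L * p)) * h := by positivity
  linarith

end Networks

variable {d N : ℕ → ℕ} {Ks : ℕ} {T : ∀ n, Networks (d n) (N n) Ks}
  {rm : ∀ n, Fin (N n + 1) → ℝ} {r : ℕ → ℝ}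

/-- The noise-to-signal ratio, also after multiplication by the logarithm of the number of
networks, is negligible. If the number of networks is bounded, then so is the pooling factor
`|I|` in the rate; otherwise the product with the logarithm is negligible by assumption, and the
logarithm is at least `log 2`. -/
lemma tendsto_ratio {h : ℕ → ℝ} {L p : ℕ → ℕ} {c₀ dτ : ℝ} (hdτ : 0 < dτ)
    (hrm : ∀ n m, 0 < rm n m) (hr : ∀ n, 0 < r n) (hh : ∀ n, 0 ≤ h n)
    (h_count : NetworkCountControlled T rm r)
    (h_rate : (fun n => (T n).S (L n) (p n) c₀ (r n) (h n) + (T n).maxNonInfoRatio (rm n))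
      =o[atTop] fun _ => dτ) :
    Tendsto (fun n => max (r n / (T n).gap 0) ((T n).maxNonInfoRatio (rm n))) atTop (𝓝 0) ∧
    Tendsto (fun n => Real.log ((N n + 1 : ℕ) : ℝ) *
      max (r n / (T n).gap 0) ((T n).maxNonInfoRatio (rm n))) atTop (𝓝 0) := by
  have hpos : ∀ n, 0 < r n / (T n).gap 0 := fun n => div_pos (hr n) ((T n).gap_pos 0)
  have hmax0 : ∀ n, 0 ≤ max (r n / (T n).gap 0) ((T n).maxNonInfoRatio (rm n)) := fun n =>
    (hpos n).le.trans (le_max_left _ _)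
  have hlog : ∀ n, Real.log 2 ≤ Real.log ((N n + 1 : ℕ) : ℝ) := fun n =>
    Real.log_le_log (by norm_num) (by exact_mod_cast (T n).two_le)
  have hlog2 : 0 < Real.log 2 := Real.log_pos (by norm_num)
  rcases h_count with ⟨B, hB⟩ | hcount
  · have hlim := (isLittleO_const_iff hdτ.ne').1 h_rate
    have hB1 : ∀ n, ((N n + 1 : ℕ) : ℝ) ≤ B := fun n => by exact_mod_cast hB n
    have hle : ∀ n, max (r n / (T n).gap 0) ((T n).maxNonInfoRatio (rm n)) ≤
        (√(B : ℝ) + 1) *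
          ((T n).S (L n) (p n) c₀ (r n) (h n) + (T n).maxNonInfoRatio (rm n)) := by
      intro n
      have h1 := (T n).sqrt_mul_ratio_le_S (L n) (p n) c₀ (hr n) (hh n)
      have h2 := (T n).maxNonInfoRatio_nonneg (hrm n)
      have h3 : 1 ≤ √(B : ℝ) * √((Ks : ℝ) / (T n).info.card) := by
        rw [← Real.sqrt_mul (by positivity)]
        refine Real.one_le_sqrt.2 ?_
        have hc : 0 < ((T n).info.card : ℝ) := by exact_mod_cast (T n).info_nonempty.card_pos
        have hcB : ((T n).info.card : ℝ) ≤ B := by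
          refine le_trans ?_ (hB1 n)
          exact_mod_cast (Finset.card_le_univ _).trans (by simp)
        have hK : (1 : ℝ) ≤ Ks := by exact_mod_cast (T n).Ks_pos
        rw [← mul_div_assoc, one_le_div hc]
        nlinarith
      set S := (T n).S (L n) (p n) c₀ (r n) (h n)
      have h4 : r n / (T n).gap 0 ≤ √(B : ℝ) * S := by
        have := mul_le_mul_of_nonneg_left h1 (Real.sqrt_nonneg (B : ℝ))
        nlinarith [hpos n]
      have hS : 0 ≤ S := le_trans (mul_nonneg (Real.sqrt_nonneg _) (hpos n).le) h1
      have hsB := Real.sqrt_nonneg (B : ℝ)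
      refine max_le ?_ ?_ <;> nlinarith
    have hlim0 : Tendsto (fun n => max (r n / (T n).gap 0) ((T n).maxNonInfoRatio (rm n)))
        atTop (𝓝 0) :=
      squeeze_zero hmax0 hle (by simpa using hlim.const_mul (√(B : ℝ) + 1))
    refine ⟨hlim0, squeeze_zero (fun n => mul_nonneg (hlog2.le.trans (hlog n)) (hmax0 n))
      (fun n => ?_) (by simpa using hlim0.const_mul (Real.log B))⟩
    refine mul_le_mul_of_nonneg_right (Real.log_le_log (by positivity) (hB1 n)) (hmax0 n)
  · refine ⟨squeeze_zero hmax0 (fun n => ?_) (by simpa using hcount.const_mul (Real.log 2)⁻¹),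
      hcount⟩
    rw [le_inv_mul_iff₀ hlog2]
    simpa using mul_le_mul_of_nonneg_right (hlog n) (hmax0 n)

/-- The rate of each network's noise is at most a constant times its eigengap times the largest
noise-to-signal ratio. -/
lemma exists_rate_le {Ω : ℕ → Type*} [∀ n, MeasurableSpace (Ω n)] {μ : ∀ n, Measure (Ω n)}
    {X : ∀ n, Fin (N n + 1) → Ω n → Matrix (Fin (d n)) (Fin (d n)) ℝ}
    (h_noise : NoiseRates T μ X rm r) (h_sources : SourceSignal T) :
    ∃ C > 0, ∀ n m, rm n m ≤
      C * max (r n / (T n).gap 0) ((T n).maxNonInfoRatio (rm n)) * (T n).gap m := by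
  obtain ⟨hrm, hr, -, C, hC, hpool⟩ := h_noise
  obtain ⟨C₀, hC₀, hsrc⟩ := h_sources
  refine ⟨C * (1 + C₀⁻¹) + 1, by positivity, fun n m => ?_⟩
  have g0 : 0 < (T n).gap 0 := (T n).gap_pos 0
  have gm : 0 < (T n).gap m := (T n).gap_pos m
  set ρ := max (r n / (T n).gap 0) ((T n).maxNonInfoRatio (rm n)) with hρ
  have hρ1 : r n ≤ ρ * (T n).gap 0 := (div_le_iff₀ g0).1 (le_max_left _ _)
  have hρ0 : 0 < ρ := lt_of_lt_of_le (div_pos (hr n) g0) (le_max_left _ _)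
  have hρgm : 0 < ρ * (T n).gap m := by positivity
  have hCi : 0 < C * (1 + C₀⁻¹) := by positivity
  by_cases hm : m ∈ (T n).pool
  · have hgap : (T n).gap 0 ≤ (1 + C₀⁻¹) * (T n).gap m := by
      rcases Finset.mem_insert.1 hm with h0 | h1
      · rw [h0]
        nlinarith [inv_pos.2 hC₀]
      · have := hsrc n m h1
        have h2 : (T n).gap 0 ≤ C₀⁻¹ * (T n).gap m := (le_inv_mul_iff₀ hC₀).2 this
        linarith
    calc rm n m ≤ C * r n := hpool n m hm
      _ ≤ C * (ρ * ((1 + C₀⁻¹) * (T n).gap m)) := by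
        gcongr
        exact hρ1.trans (by gcongr)
      _ ≤ (C * (1 + C₀⁻¹) + 1) * ρ * (T n).gap m := by linarith
  · have h1 : rm n m / (T n).gap m ≤ (T n).maxNonInfoRatio (rm n) :=
      le_ciSup (f := fun m : {m // m ∈ (T n).nonInfo} => rm n m / (T n).gap m)
        (Set.finite_range _).bddAbove ⟨m, by simpa [Networks.nonInfo] using hm⟩
    have h2 : rm n m ≤ ρ * (T n).gap m := (div_le_iff₀ gm).1 (h1.trans (le_max_right _ _))
    nlinarith

/-- With probability tending to one, the noise of every network is small compared with its
eigengap. -/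
lemma tendsto_measure_noise_le {Ω : ℕ → Type*} [∀ n, MeasurableSpace (Ω n)]
    {μ : ∀ n, Measure (Ω n)} [∀ n, IsProbabilityMeasure (μ n)]
    {X : ∀ n, Fin (N n + 1) → Ω n → Matrix (Fin (d n)) (Fin (d n)) ℝ}
    (hX : ∀ n, IsObserved (T n) (μ n) (X n))
    (h_noise : NoiseRates T μ X rm r) (h_sources : SourceSignal T)
    (h_lim : Tendsto (fun n => max (r n / (T n).gap 0) ((T n).maxNonInfoRatio (rm n)))
      atTop (𝓝 0))
    (h_log : Tendsto (fun n => Real.log ((N n + 1 : ℕ) : ℝ) *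
      max (r n / (T n).gap 0) ((T n).maxNonInfoRatio (rm n))) atTop (𝓝 0))
    {ε : ℝ} (hε : 0 < ε) :
    Tendsto (fun n => μ n {ω | ∀ m, specNorm (X n m ω - ((T n).net m).H) ≤ ε * (T n).gap m})
      atTop (𝓝 1) := by
  obtain ⟨C₂, hC₂, hrate⟩ := exists_rate_le h_noise h_sources
  obtain ⟨hrm, hr, ⟨C₁, hC₁, hpsi⟩, -⟩ := h_noise
  set ρ : ℕ → ℝ := fun n => max (r n / (T n).gap 0) ((T n).maxNonInfoRatio (rm n)) with hρ
  have hρ0 : ∀ n, 0 < ρ n := fun n =>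
    lt_of_lt_of_le (div_pos (hr n) ((T n).gap_pos 0)) (le_max_left _ _)
  set a : ℝ := ε / (Real.exp 1 * C₁ * C₂) with ha
  have ha0 : 0 < a := by positivity
  -- the order of the moment in Markov's inequality
  set q : ℕ → ℝ := fun n => a / ρ n with hq
  have hqtop : Tendsto q atTop atTop := by
    have h1 : Tendsto ρ atTop (𝓝[>] 0) :=
      tendsto_nhdsWithin_iff.2 ⟨h_lim, Eventually.of_forall hρ0⟩
    exact (tendsto_inv_nhdsGT_zero.comp h1).const_mul_atTop ha0
  have hmeas : ∀ n, MeasurableSet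
      {ω | ∀ m, specNorm (X n m ω - ((T n).net m).H) ≤ ε * (T n).gap m} := fun n => by
    rw [Set.ofPred_forall]
    exact MeasurableSet.iInter fun m =>
      measurableSet_le (measurable_specNorm_sub (hX n) m) measurable_const
  have hbound : ∀ᶠ n in atTop,
      μ n {ω | ∀ m, specNorm (X n m ω - ((T n).net m).H) ≤ ε * (T n).gap m}ᶜ ≤
        ENNReal.ofReal (Real.exp (-(q n / 2))) := by
    filter_upwards [hqtop.eventually_ge_atTop 1,
      h_log.eventually (gt_mem_nhds (half_pos ha0))] with n hq1 hlog
    have hsub : {ω | ∀ m, specNorm (X n m ω - ((T n).net m).H) ≤ ε * (T n).gap m}ᶜ ⊆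
        ⋃ m, {ω | ε * (T n).gap m ≤ |specNorm (X n m ω - ((T n).net m).H)|} := by
      intro ω hω
      simp only [Set.mem_compl_iff, Set.mem_ofPred_eq, not_forall, not_le] at hω
      obtain ⟨m, hm⟩ := hω
      exact Set.mem_iUnion.2 ⟨m, hm.le.trans (le_abs_self _)⟩
    have htail : ∀ m, μ n {ω | ε * (T n).gap m ≤ |specNorm (X n m ω - ((T n).net m).H)|} ≤
        ENNReal.ofReal (Real.exp (-q n)) := by
      intro m
      have gm : 0 < (T n).gap m := (T n).gap_pos m
      refine measure_ge_le_of_psiOneNorm_le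
        (measurable_specNorm_sub (hX n) m).aestronglyMeasurable (by positivity) hq1 (hpsi n m) ?_
      have hqn : 0 < q n := by linarith
      calc Real.exp 1 * q n * (C₁ * rm n m)
          ≤ Real.exp 1 * q n * (C₁ * (C₂ * ρ n * (T n).gap m)) := by
            gcongr
            exact hrate n m
        _ = ε * (T n).gap m := by
            have := (hρ0 n).ne'
            simp only [hq, ha]
            field_simp
    refine (measure_mono hsub).trans ((measure_iUnion_le _).trans ?_)
    rw [tsum_fintype]
    refine (Finset.sum_le_sum fun m _ => htail m).trans ?_
    rw [Finset.sum_const, Finset.card_univ, Fintype.card_fin, nsmul_eq_mul,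
      ← ENNReal.ofReal_natCast, ← ENNReal.ofReal_mul (by positivity)]
    refine ENNReal.ofReal_le_ofReal ?_
    have hN : (0 : ℝ) < ((N n + 1 : ℕ) : ℝ) := by positivity
    rw [← Real.exp_log hN, ← Real.exp_add]
    refine Real.exp_le_exp.2 ?_
    have h1 : Real.log ((N n + 1 : ℕ) : ℝ) ≤ q n / 2 := by
      have : Real.log ((N n + 1 : ℕ) : ℝ) * ρ n ≤ a / 2 := hlog.le
      simp only [hq]
      rw [div_div, mul_comm (ρ n), ← div_div, le_div_iff₀ (hρ0 n)]
      exact this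
    linarith
  have hcompl : Tendsto (fun n => μ n
      {ω | ∀ m, specNorm (X n m ω - ((T n).net m).H) ≤ ε * (T n).gap m}ᶜ) atTop (𝓝 0) := by
    refine tendsto_of_tendsto_of_tendsto_of_le_of_le' tendsto_const_nhds ?_
      (Eventually.of_forall fun _ => zero_le) hbound
    have h1 : Tendsto (fun n => Real.exp (-(q n / 2))) atTop (𝓝 0) :=
      Real.tendsto_exp_neg_atTop_nhds_zero.comp (hqtop.atTop_div_const two_pos)
    simpa using ENNReal.tendsto_ofReal h1
  have h1 : ∀ n, μ n {ω | ∀ m, specNorm (X n m ω - ((T n).net m).H) ≤ ε * (T n).gap m} =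
      1 - μ n {ω | ∀ m, specNorm (X n m ω - ((T n).net m).H) ≤ ε * (T n).gap m}ᶜ := fun n => by
    rw [← prob_compl_eq_one_sub (hmeas n).compl, compl_compl]
  simp only [h1]
  simpa using ENNReal.Tendsto.sub tendsto_const_nhds hcompl (Or.inl ENNReal.one_ne_top)

/-- A null sequence with values below `1` stays away from `1`. -/
lemma exists_le_one_sub_of_tendsto {g : ℕ → ℝ} {k : ℕ} (hg1 : ∀ M, k ≤ M → g M < 1)
    (hg : Tendsto g atTop (𝓝 0)) : ∃ γ > 0, ∀ M, k ≤ M → g M ≤ 1 - γ := by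
  obtain ⟨M₀, hM₀⟩ := eventually_atTop.1 (hg.eventually (gt_mem_nhds (half_pos one_pos)))
  have h : ∀ n, ∃ γ > 0, ∀ M, k ≤ M → M < n → g M ≤ 1 - γ := by
    intro n
    induction n with
    | zero => exact ⟨1, one_pos, fun M _ h => absurd h (Nat.not_lt_zero _)⟩
    | succ n ih =>
      obtain ⟨γ, hγ, h⟩ := ih
      by_cases hn : k ≤ n
      · refine ⟨min γ (1 - g n), lt_min hγ (by linarith [hg1 n hn]), fun M hM hMn => ?_⟩
        rcases Nat.lt_succ_iff_lt_or_eq.1 hMn with h1 | rfl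
        · linarith [h M hM h1, min_le_left γ (1 - g n)]
        · linarith [min_le_right γ (1 - g M)]
      · exact ⟨γ, hγ, fun M hM hMn => h M hM (by omega)⟩
  obtain ⟨γ, hγ, hγM⟩ := h M₀
  refine ⟨min γ (1 / 2), lt_min hγ (by norm_num), fun M hM => ?_⟩
  rcases lt_or_ge M M₀ with h1 | h1
  · linarith [hγM M hM h1, min_le_left γ (1 / 2)]
  · linarith [hM₀ M h1, min_le_right γ (1 / 2)]

end Rates

end TDCMM

/-- With probability tending to one, every solution of the oracle problem is a local maximizer of
the truncated objective on `O(d, K_s)`. -/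
theorem theorem2 {d N : ℕ → ℕ} {Ks : ℕ} (T : ∀ n, TDCMM.Networks (d n) (N n) Ks)
    {Ω : ℕ → Type*} [∀ n, MeasurableSpace (Ω n)] (μ : ∀ n, Measure (Ω n))
    [∀ n, IsProbabilityMeasure (μ n)]
    (X : ∀ n, Fin (N n + 1) → Ω n → Matrix (Fin (d n)) (Fin (d n)) ℝ)
    (hX : ∀ n, TDCMM.IsObserved (T n) (μ n) (X n))
    (rm : ∀ n, Fin (N n + 1) → ℝ) (r h g β βt : ℕ → ℝ) (dτ : ℝ)
    (hd : Tendsto d atTop atTop) (hh : Tendsto h atTop (𝓝 0))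
    (h_degrees : TDCMM.DegreesComparable T)
    (h_noise : TDCMM.NoiseRates T μ X rm r)
    (h_subspaces : TDCMM.SubspacesIdentifiable T h g)
    (h_eigenvalues : TDCMM.EigenvaluesSeparated T β βt)
    (h_sources : TDCMM.SourceSignal T)
    (h_bounded : TDCMM.DegreesBounded T)
    (h_communities : TDCMM.CommunitiesBounded T)
    (h_singVal : TDCMM.SingularValuesSeparated T)
    (h_singVec : TDCMM.SingularVectorPositive T)
    (h_dτ : 0 < dτ) (h_separated : TDCMM.NonInfoSeparated T dτ)
    (h_count : TDCMM.NetworkCountControlled T rm r)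
    (L p : ℕ → ℕ) (hL : ∀ n, 0 < L n) (hp : ∀ n, Ks < p n) (c₀ : ℝ) (hc₀ : 0 < c₀)
    (h_rate : (fun n => (T n).S (L n) (p n) c₀ (r n) (h n) + (T n).maxNonInfoRatio (rm n))
      =o[atTop] fun _ => dτ)
    (c : ℝ) (hc : c ∈ Set.Ioo (1 / 2 : ℝ) 1)
    (τ : ℕ → ℝ) (hτ : ∀ n, τ n ∈ Set.Icc ((1 - c) * dτ) (c * dτ)) :
    ∃ A : ∀ n, Set (Ω n), (∀ n, MeasurableSet (A n)) ∧
      Tendsto (fun n => μ n (A n)) atTop (𝓝 1) ∧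
      ∀ n, ∀ ω ∈ A n,
        ∀ V : ∀ m, Matrix (Fin (d n)) (Fin ((T n).K m)) ℝ, (∀ m, TDCMM.IsLeading (X n m ω) (V m)) →
          ∀ U, (T n).IsOracleEstimator V U →
            IsLocalMaxOn ((T n).truncObj V (τ n)) (TDCMM.stiefel (d n) Ks) U := by
  obtain ⟨hh0, hS, hg01, hg, hgavg⟩ := h_subspaces
  obtain ⟨γ, hγ, hgγ⟩ := TDCMM.exists_le_one_sub_of_tendsto (fun M hM => (hg01 M hM).2) hg
  obtain ⟨hlim, hlog⟩ := TDCMM.tendsto_ratio h_dτ h_noise.1 h_noise.2.1 hh0 h_count h_rate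
  -- below this noise-to-eigengap ratio, the errors of all overlaps stay under the margin
  -- `(1 - c) dτ` between the thresholds `τ` and the ends `0`, `dτ` of their range
  obtain ⟨ε, hε0, hε, hsmall⟩ : ∃ ε : ℝ, 0 < ε ∧ ε ≤ 1 / 2 ∧
      2 * Ks * (4 * ε) + 2 * Ks * √(12 * Ks * (4 * ε) / γ) < (1 - c) * dτ := by
    have hcont : Continuous fun ε : ℝ =>
        2 * Ks * (4 * ε) + 2 * Ks * √(12 * Ks * (4 * ε) / γ) := by fun_prop
    have h0 := hcont.tendsto 0
    simp only [mul_zero, zero_div, Real.sqrt_zero, add_zero] at h0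
    have hpos : 0 < (1 - c) * dτ := mul_pos (by linarith [hc.2]) h_dτ
    have hev := (h0.eventually (gt_mem_nhds hpos)).and
      (ge_mem_nhds (show (0 : ℝ) < 1 / 2 by norm_num))
    obtain ⟨ε, ⟨h1, h2⟩, h3⟩ :=
      ((hev.filter_mono nhdsWithin_le_nhds).and
        (eventually_mem_nhdsWithin (a := (0 : ℝ)) (s := Set.Ioi 0))).exists
    exact ⟨ε, h3, h2, h1⟩
  have hnoise := TDCMM.tendsto_measure_noise_le hX h_noise h_sources hlim hlog hε0
  refine ⟨fun n => {ω | h n ≤ ε ∧ ∀ m, TDCMM.specNorm (X n m ω - ((T n).net m).H) ≤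
    ε * (T n).gap m}, fun n => ?_, ?_, fun n ω hω V hV U hU => ?_⟩
  · have : MeasurableSet {ω | ∀ m, TDCMM.specNorm (X n m ω - ((T n).net m).H) ≤
        ε * (T n).gap m} := by
      rw [Set.ofPred_forall]
      exact MeasurableSet.iInter fun m =>
        measurableSet_le (TDCMM.measurable_specNorm_sub (hX n) m) measurable_const
    exact (MeasurableSet.const _).inter this
  · refine hnoise.congr' ?_
    filter_upwards [hh.eventually (ge_mem_nhds hε0)] with n hn
    simp only [hn, true_and]
  · exact TDCMM.Networks.isLocalMaxOn_truncObj_of_small_noise hV hU hε0.le hε hγ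
      (hgγ _ (Nat.succ_le_succ (T n).info_nonempty.card_pos)) hω.2
      (fun m hm => (hS n m hm).trans hω.1) (hgavg n) (h_separated n) (hτ n) hsmall
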